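/- A finite polycyclic presentation $\mathcal F=\{\mathcal A\mid\mathcal R\}$ consists of ordered generators $\mathcal A=\{a_1<\dots<a_m\}$, positive integers $e_1,\dots,e_m$ and relations $a_i^{e_i}=v_{ii}$ ($1\le i\le m$) and $a_ja_i=a_iv_{ij}$ ($1\le i<j\le m$), where each $v_{ij}$ ($i\le j$) is a normal word in $\{a_{i+1},\dots,a_m\}$; here the normal words are the words $a_1^{\alpha_1}\cdots a_m^{\alpha_m}$ with $0\le\alpha_i<e_i$. It is consistent if the group it defines has order $e_1\cdots e_m$. It is favourable if there are a positive integer $d$ and a non-decreasing surjection $\delta:\mathcal A\to\{1,\dots,d\}$ such that each $v_{ii}$ is either $a_{i+1}$ or a normal word in the generators $a_k$ with $\delta(a_k)>\delta(a_i)$, and for $i<j$ each $v_{ij}$ is a normal word equal to $v^*_{ij}$ or to $a_jv^*_{ij}$, where $v^*_{ij}$ is a normal word in the generators $a_k$ with $\delta(a_k)>\delta(a_i)$. When all $e_i>1$, the left-hand sides of the relations are exactly the minimal non-normal words, and a step of collection from the left replaces the left-most subword that is the left-hand side of a relation with the right-hand side of that relation. **Corollary.** Let $p$ be a prime and let $G$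 be a non-trivial finite $p$-group. Then $G$ has a consistent favourable polycyclic presentation, with all $e_i>1$, with respect to which every concatenation of two normal words can be collected from the left to a normal word in at most $$\bigl((p-1)\log_p|G|\bigr)^{3\log_2\log_p|G|+1}$$ steps. -/

import Mathlib

/-- Non-negative words in the ordered alphabet `a_0 < a_1 < ... < a_{m-1}`, letters being named by
their index. -/
abbrev PWord (m : ℕ) : Type := List (Fin m)

/-- The normal words: the words `a_0 ^ α_0 * ... * a_{m-1} ^ α_{m-1}` with `0 ≤ α_i < e_i`, i.e. the
words whose letters are in non-decreasing order and in which `a_i` occurs fewer than `e_i` times. -/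
def IsNormalWord {m : ℕ} (e : Fin m → ℕ) (w : PWord m) : Prop :=
  w.Pairwise (· ≤ ·) ∧ ∀ i, w.count i < e i

/-- A finite polycyclic presentation on `a_0 < ... < a_{m-1}`, with the relations
`a_i ^ (e_i) = v_ii` and, for `i < j`, `a_j * a_i = a_i * v_ij`. The `v_ij` with `i ≤ j` are normal
words in the letters after `a_i`; the values `v i j` for `j < i` are never used. -/
structure PolycyclicPresentation (m : ℕ) where
  e : Fin m → ℕ
  v : Fin m → Fin m → PWord m
  e_pos : ∀ i, 0 < e i
  v_normal : ∀ i j, i ≤ j → IsNormalWord e (v i j)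
  v_letters : ∀ i j, i ≤ j → ∀ k ∈ v i j, i < k

namespace PolycyclicPresentation

variable {m : ℕ} (F : PolycyclicPresentation m)

/-- `F.Rel l r` says that `l = r` is one of the relations, with left-hand side `l` and right-hand
side `r`. If all `e_i > 1`, the left-hand sides are exactly the minimal non-normal words. -/
inductive Rel : PWord m → PWord m → Prop
  | power (i : Fin m) : Rel (List.replicate (F.e i) i) (F.v i i)
  | swap (i j : Fin m) (hij : i < j) : Rel [j, i] (i :: F.v i j)

/-- The element of the free group on the generators that a word represents. -/
def toFree (w : PWord m) : FreeGroup (Fin m) := (w.map FreeGroup.of).prod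

/-- The relators `l * r⁻¹`, for `l = r` a relation of the presentation. -/
def relators : Set (FreeGroup (Fin m)) :=
  {g | ∃ l r, F.Rel l r ∧ g = toFree l * (toFree r)⁻¹}

/-- `F` is a presentation of the group `G`. -/
def Presents (G : Type*) [Group G] : Prop :=
  Nonempty (PresentedGroup F.relators ≃* G)

/-- `F` is consistent: the group that it defines has order `e_0 * ... * e_{m-1}`. -/
def Consistent : Prop :=
  Nat.card (PresentedGroup F.relators) = ∏ i, F.e i

/-- `F` is favourable: there are a positive integer `d` and a non-decreasing surjection `δ` from the
generators onto a chain of `d` elements such that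
* each `v_ii` is `a_{i+1}` or a normal word in the letters `a_k` with `δ a_k > δ a_i`;
* each `v_ij` with `i < j` is `v*` or `a_j * v*` for a normal word `v*` in the letters `a_k` with
  `δ a_k > δ a_i`. -/
def Favourable : Prop :=
  ∃ d : ℕ, 0 < d ∧ ∃ δ : Fin m → Fin d, Monotone δ ∧ Function.Surjective δ ∧
    (∀ i : Fin m, (∃ k : Fin m, (k : ℕ) = (i : ℕ) + 1 ∧ F.v i i = [k]) ∨
      (IsNormalWord F.e (F.v i i) ∧ ∀ k ∈ F.v i i, δ i < δ k)) ∧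
    (∀ i j : Fin m, i < j → IsNormalWord F.e (F.v i j) ∧
      ∃ vs : PWord m, IsNormalWord F.e vs ∧ (∀ k ∈ vs, δ i < δ k) ∧
        (F.v i j = vs ∨ F.v i j = j :: vs))

/-- One step of collection from the left: the left-most occurrence of a left-hand side of a relation
is replaced with the corresponding right-hand side. -/
def LeftStep (w w' : PWord m) : Prop :=
  ∃ x l r y : PWord m, F.Rel l r ∧ w = x ++ l ++ y ∧ w' = x ++ r ++ y ∧
    ∀ x' l' r' y' : PWord m, F.Rel l' r' → w = x' ++ l' ++ y' → x.length ≤ x'.length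

/-- `F.LeftCollects k w w'`: exactly `k` steps of collection from the left lead from `w` to `w'`. -/
inductive LeftCollects : ℕ → PWord m → PWord m → Prop
  | refl (w : PWord m) : LeftCollects 0 w w
  | step {k : ℕ} {w w' w'' : PWord m} :
      F.LeftStep w w' → LeftCollects k w' w'' → LeftCollects (k + 1) w w''

end PolycyclicPresentation

/-! Write |G| = p^m, K = m(p-1), and let L_k be the term γ_{2^k} of the lower central series. As
[γ_a, γ_b] ≤ γ_{a+b}, the commutator subgroup of L_k lies in L_{k+1}; as γ_{j+1} ≠ 1 forces j < m,
the last non-trivial term L_E satisfies 2^E ≤ m. So there are few levels. Splitting each abelian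
factor L_k/L_{k+1} into cyclic p-groups and taking g, g^p, g^{p^2}, … in each of them gives m
generators, and with them a favourable presentation (`GenSeq.exists_of_series`,
`LevelBasis.exists_presentation`).

In such a presentation a conjugate of a letter of the same level is that letter followed by deeper
letters, and a conjugate of a deeper letter is a word in deeper letters. Hence appending a letter to
a normal word only rearranges letters of its own level, in order, and otherwise amounts to appending
deeper letters. This gives a recursion over the levels (`LevelStep.letterBound`): the deepest level
costs at most 2K steps per letter, and each further level multiplies the cost by at most K^3
(`letterBound_succ`), the factor 2 being absorbed on the way.

For E ≥ 1 the cost of a letter is thus K^{3E+1}. A cost K^t is good enough if 2^t ≤ m^3, because the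
second word has at most K letters. The surplus factor K is harmless if 3·2^E ≤ 2m. Otherwise
γ_{3·2^{E-1}} = 1, so L_{E-1} and L_E commute, the two deepest levels together cost only K^3
(`letterBound_of_commute`), and t = 3E suffices.

Consistency is a by-product: since products of normal words collect to normal words, the presented
group has at most p^m elements, and it maps onto G (`presents_and_consistent`). -/

/-! ### Normal words -/

section NormalWords

variable {m : ℕ} {e : Fin m → ℕ}

theorem IsNormalWord.sublist {x y : PWord m} (hy : IsNormalWord e y) (h : x.Sublist y) :
    IsNormalWord e x :=
  ⟨hy.1.sublist h, fun i => (h.count_le i).trans_lt (hy.2 i)⟩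

theorem IsNormalWord.infix {x y : PWord m} (hy : IsNormalWord e y) (h : x <:+: y) :
    IsNormalWord e x :=
  hy.sublist h.sublist

theorem isNormalWord_nil (he : ∀ i, 0 < e i) : IsNormalWord e ([] : PWord m) :=
  ⟨List.Pairwise.nil, by simpa using he⟩

theorem isNormalWord_singleton (he : ∀ i, 1 < e i) (i : Fin m) : IsNormalWord e [i] :=
  ⟨List.pairwise_singleton _ _, fun j =>
    lt_of_le_of_lt (by simpa using List.count_le_length (l := [i])) (he j)⟩

theorem IsNormalWord.append {x y : PWord m} (hx : IsNormalWord e x) (hy : IsNormalWord e y)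
    (h : ∀ a ∈ x, ∀ b ∈ y, a < b) : IsNormalWord e (x ++ y) := by
  refine ⟨List.pairwise_append.2 ⟨hx.1, hy.1, fun a ha b hb => (h a ha b hb).le⟩, fun i => ?_⟩
  rw [List.count_append]
  by_cases hi : i ∈ x
  · have : i ∉ y := fun hiy => lt_irrefl _ (h i hi i hiy)
    rw [List.count_eq_zero_of_not_mem this]; simpa using hx.2 i
  · rw [List.count_eq_zero_of_not_mem hi]; simpa using hy.2 i

/-- A sorted word is the concatenation of its letters outside and inside an upper set. -/
theorem List.eq_filter_append_of_isUpperSet {w : PWord m} (hw : w.Pairwise (· ≤ ·))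
    {B : Finset (Fin m)} (hB : IsUpperSet (B : Set (Fin m))) :
    w = w.filter (· ∉ B) ++ w.filter (· ∈ B) := by
  induction w with
  | nil => rfl
  | cons a w ih =>
    rw [List.pairwise_cons] at hw
    by_cases ha : a ∈ B
    · have h : ∀ b ∈ w, b ∈ B := fun b hb => hB (hw.1 b hb) ha
      have h1 : w.filter (· ∉ B) = [] := by
        rw [List.filter_eq_nil_iff]; intro b hb; simpa using h b hb
      have h2 : w.filter (· ∈ B) = w := by
        rw [List.filter_eq_self]; intro b hb; simpa using h b hb
      rw [List.filter_cons_of_neg (by simpa using ha), List.filter_cons_of_pos (by simpa using ha),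
        h1, h2, List.nil_append]
    · conv_lhs => rw [ih hw.2]
      simp [ha]

theorem length_le_of_isNormalWord {w : PWord m} (hw : IsNormalWord e w) {A : Finset (Fin m)}
    (hA : ∀ a ∈ w, a ∈ A) : w.length ≤ ∑ i ∈ A, (e i - 1) := by
  have h1 : w.length = ∑ i ∈ A, w.count i := by
    have := Multiset.sum_count_eq_card (s := A) (m := (w : Multiset (Fin m))) (by simpa using hA)
    simpa using this.symm
  rw [h1]
  exact Finset.sum_le_sum fun i _ => by have := hw.2 i; omega

end NormalWords

/-! ### Steps and runs of collection from the left -/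

namespace PolycyclicPresentation

variable {m : ℕ} {F : PolycyclicPresentation m}

theorem Rel.not_normal {l r : PWord m} (h : F.Rel l r) : ¬ IsNormalWord F.e l := by
  cases h with
  | power i => intro h; have := h.2 i; simp at this
  | swap i j hij => intro h; have := h.1; simp at this; omega

theorem Rel.tail_normal (he : ∀ i, 1 < F.e i) {l r : PWord m} (h : F.Rel l r) :
    IsNormalWord F.e l.tail := by
  cases h with
  | power i =>
    refine ⟨by simp [List.pairwise_replicate], fun j => ?_⟩
    rw [List.tail_replicate, List.count_replicate]
    have := he j
    split_ifs with h
    · have h := eq_of_beq h; subst h; omega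
    · omega
  | swap i j hij => exact isNormalWord_singleton he i

/-- An earlier left-hand side would properly contain a given one, which minimality forbids. -/
theorem Rel.no_earlier (he : ∀ i, 1 < F.e i) {x l y x' l' r' y' : PWord m}
    (hl : ¬ IsNormalWord F.e l) (h' : F.Rel l' r') (heq : x ++ l ++ y = x' ++ l' ++ y')
    (h1 : x'.length < x.length) (h2 : x.length + l.length ≤ x'.length + l'.length) : False := by
  apply hl
  refine (h'.tail_normal he).infix ?_
  obtain ⟨t, rfl⟩ : x' <+: x := by
    refine List.prefix_of_prefix_length_le (l₃ := x ++ l ++ y) ?_ ?_ h1.le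
    · rw [heq]; simp
    · simp
  simp only [List.append_assoc, List.append_cancel_left_eq] at heq
  have h3 : t ++ l <+: l' := by
    refine List.prefix_of_prefix_length_le (l₃ := l' ++ y') ?_ (by simp) ?_
    · rw [← heq, ← List.append_assoc]; simp
    · simp at h2 ⊢; omega
  obtain ⟨s, hs⟩ := h3
  cases t with
  | nil => simp at h1
  | cons a t => exact ⟨t, s, by rw [← hs]; simp⟩

/-- A left-hand side starting before `l` would either end inside the normal word `x ++ l.dropLast`,
or contain `l` in its tail; both are impossible. -/
theorem leftStep_of_normal (he : ∀ i, 1 < F.e i) {x l r : PWord m} (y : PWord m) (h : F.Rel l r)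
    (hx : IsNormalWord F.e (x ++ l.dropLast)) : F.LeftStep (x ++ l ++ y) (x ++ r ++ y) := by
  refine ⟨x, l, r, y, h, rfl, rfl, fun x' l' r' y' h' heq => ?_⟩
  by_contra! hlt
  by_cases hlen : x.length + l.length ≤ x'.length + l'.length
  · exact Rel.no_earlier he h.not_normal h' heq hlt hlen
  · refine h'.not_normal (hx.infix ?_)
    have : x' ++ l' <+: x ++ l.dropLast := by
      refine List.prefix_of_prefix_length_le (l₃ := x ++ l ++ y) ?_ ?_ ?_
      · rw [heq]; simp
      · rw [List.append_assoc, List.prefix_append_right_inj]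
        exact (List.dropLast_prefix l).trans (List.prefix_append _ _)
      · simp; omega
    obtain ⟨s, hs⟩ := this
    exact ⟨x', s, hs⟩

/-- A left-hand side that starts before `l` and reaches into `y` would properly contain `l`, so no
new left-most redex arises. This lets prefixes be collected separately. -/
theorem LeftStep.append (he : ∀ i, 1 < F.e i) {w w' : PWord m} (h : F.LeftStep w w')
    (y : PWord m) : F.LeftStep (w ++ y) (w' ++ y) := by
  obtain ⟨x, l, r, z, hr, rfl, rfl, hmin⟩ := h
  refine ⟨x, l, r, z ++ y, hr, by simp, by simp, fun x' l' r' y' h' heq => ?_⟩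
  by_contra! hlt
  by_cases hlen : x.length + l.length ≤ x'.length + l'.length
  · exact Rel.no_earlier he (y := z ++ y) hr.not_normal h' (by rw [← heq]; simp) hlt hlen
  · have : x' ++ l' <+: x ++ l ++ z := by
      refine List.prefix_of_prefix_length_le (l₃ := x ++ l ++ z ++ y) ?_ (by simp) ?_
      · rw [heq]; simp
      · simp; omega
    obtain ⟨s, hs⟩ := this
    exact absurd (hmin x' l' r' s h' hs.symm) (by omega)

variable (F) in
/-- At most `n` steps of collection from the left lead from `w` to `z`. -/
def CollectsWithin (n : ℕ) (w z : PWord m) : Prop := ∃ k ≤ n, F.LeftCollects k w z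

theorem CollectsWithin.refl (n : ℕ) (w : PWord m) : F.CollectsWithin n w w :=
  ⟨0, n.zero_le, .refl w⟩

theorem CollectsWithin.mono {n n' : ℕ} {w z : PWord m} (h : F.CollectsWithin n w z)
    (hn : n ≤ n') : F.CollectsWithin n' w z :=
  let ⟨k, hk, hc⟩ := h; ⟨k, hk.trans hn, hc⟩

theorem LeftCollects.trans {a b : ℕ} {w z u : PWord m} (h : F.LeftCollects a w z)
    (h' : F.LeftCollects b z u) : F.LeftCollects (a + b) w u := by
  induction h with
  | refl w => simpa using h'
  | step hs _ ih => rw [Nat.add_right_comm]; exact .step hs (ih h')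

theorem LeftCollects.append (he : ∀ i, 1 < F.e i) {a : ℕ} {w z : PWord m}
    (h : F.LeftCollects a w z) (y : PWord m) : F.LeftCollects a (w ++ y) (z ++ y) := by
  induction h with
  | refl w => exact .refl _
  | step hs _ ih => exact .step (hs.append he y) ih

theorem CollectsWithin.trans {a b : ℕ} {w z u : PWord m} (h : F.CollectsWithin a w z)
    (h' : F.CollectsWithin b z u) : F.CollectsWithin (a + b) w u :=
  let ⟨k, hk, hc⟩ := h; let ⟨k', hk', hc'⟩ := h'
  ⟨k + k', add_le_add hk hk', hc.trans hc'⟩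

theorem CollectsWithin.append (he : ∀ i, 1 < F.e i) {a : ℕ} {w z : PWord m}
    (h : F.CollectsWithin a w z) (y : PWord m) : F.CollectsWithin a (w ++ y) (z ++ y) :=
  let ⟨k, hk, hc⟩ := h; ⟨k, hk, hc.append he y⟩

theorem CollectsWithin.of_leftStep {w z : PWord m} (h : F.LeftStep w z) :
    F.CollectsWithin 1 w z :=
  ⟨1, le_rfl, .step h (.refl _)⟩

/-- A letter moves to the left past all greater letters of a normal word. -/
theorem collectsWithin_moveLeft (he : ∀ i, 1 < F.e i) (P T : PWord m) (i : Fin m)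
    (hn : IsNormalWord F.e (P ++ T)) (hT : ∀ t ∈ T, i < t) :
    F.CollectsWithin T.length (P ++ T ++ [i]) (P ++ [i] ++ T.flatMap (F.v i)) := by
  induction T using List.reverseRecOn with
  | nil => simpa using CollectsWithin.refl _ _
  | append_singleton T j ih =>
    -- The last letter of the normal word is passed first; its conjugate stays at the right end and
    -- does not disturb the later steps.
    have hs : F.LeftStep (P ++ T ++ [j, i] ++ []) (P ++ T ++ (i :: F.v i j) ++ []) :=
      leftStep_of_normal he [] (.swap i j (hT j (by simp))) (by simpa using hn)
    have h1 := CollectsWithin.of_leftStep hs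
    have h2 := (ih (hn.sublist (by simp)) fun t ht => hT t (by simp [ht])).append he (F.v i j)
    have h3 : F.CollectsWithin (1 + T.length) (P ++ T ++ [j, i] ++ [])
        (P ++ [i] ++ T.flatMap (F.v i) ++ F.v i j) := h1.trans (by simpa using h2)
    simpa [add_comm] using h3

/-- A letter at the end of a word all of whose letters are at most that letter either gives a normal
word or can be removed with a power relation. -/
theorem normal_or_power (he : ∀ i, 1 < F.e i) {Q : PWord m} {j : Fin m}
    (hQ : IsNormalWord F.e Q) (hj : ∀ q ∈ Q, q ≤ j) :
    IsNormalWord F.e (Q ++ [j]) ∨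
      ∃ Q₀, Q = Q₀ ++ List.replicate (F.e j - 1) j ∧ (∀ q ∈ Q₀, q < j) ∧
        F.LeftStep (Q ++ [j]) (Q₀ ++ F.v j j) := by
  have hB : IsUpperSet ((Finset.univ.filter (j ≤ ·) : Finset (Fin m)) : Set (Fin m)) := by
    intro a b hab ha
    simp at ha ⊢
    exact ha.trans hab
  have hdec := List.eq_filter_append_of_isUpperSet hQ.1 hB
  set Q₀ := Q.filter (· ∉ Finset.univ.filter (j ≤ ·)) with hQ₀
  have hQ₀' : ∀ q ∈ Q₀, q < j := by
    intro q hq; simp [hQ₀] at hq; exact hq.2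
  have hrep : Q.filter (· ∈ Finset.univ.filter (j ≤ ·)) = List.replicate (Q.count j) j := by
    rw [← List.filter_eq]
    refine List.filter_congr fun q hq => ?_
    have := hj q hq
    simp [le_antisymm_iff, this]
  rw [hrep] at hdec
  have hc := hQ.2 j
  by_cases hlast : Q.count j = F.e j - 1
  · right
    rw [hlast] at hdec
    refine ⟨Q₀, hdec, hQ₀', ?_⟩
    have h : F.LeftStep (Q₀ ++ List.replicate (F.e j) j ++ []) (Q₀ ++ F.v j j ++ []) := by
      refine leftStep_of_normal he [] (.power j) ?_
      rw [List.dropLast_replicate, ← hdec]; exact hQ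
    have h2 : Q ++ [j] = Q₀ ++ List.replicate (F.e j) j := by
      obtain ⟨n, hn⟩ : ∃ n, F.e j = n + 1 := ⟨F.e j - 1, by have := he j; omega⟩
      rw [hdec, hn, List.replicate_succ']; simp
    rw [h2]; simpa using h
  · left
    refine ⟨List.pairwise_append.2 ⟨hQ.1, by simp, by simpa using hj⟩, fun i => ?_⟩
    rw [List.count_append, List.count_singleton]
    have := hQ.2 i
    split_ifs with h
    · have h := eq_of_beq h; subst h; omega
    · omega

/-! ### Collecting one letter: from a level to the previous one -/

/-- Appending a letter from `A` to a normal word can be collected in at most `f` steps, which do not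
touch the letters outside the upper set `A`. -/
def LetterBound (F : PolycyclicPresentation m) (A : Finset (Fin m)) (f : ℕ) : Prop :=
  ∀ (Q T : PWord m) (b : Fin m), IsNormalWord F.e (Q ++ T) → (∀ q ∈ Q, q ∉ A) →
    (∀ t ∈ T, t ∈ A) → b ∈ A → ∃ T', IsNormalWord F.e (Q ++ T') ∧ (∀ t ∈ T', t ∈ A) ∧
      F.CollectsWithin f (Q ++ T ++ [b]) (Q ++ T')

theorem LetterBound.word (he : ∀ i, 1 < F.e i) {A : Finset (Fin m)} {f : ℕ}
    (h : F.LetterBound A f) {Q T : PWord m} (u : PWord m) (hn : IsNormalWord F.e (Q ++ T))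
    (hQ : ∀ q ∈ Q, q ∉ A) (hT : ∀ t ∈ T, t ∈ A) (hu : ∀ t ∈ u, t ∈ A) :
    ∃ T', IsNormalWord F.e (Q ++ T') ∧ (∀ t ∈ T', t ∈ A) ∧
      F.CollectsWithin (u.length * f) (Q ++ T ++ u) (Q ++ T') := by
  induction u generalizing T with
  | nil => exact ⟨T, hn, hT, by simpa using CollectsWithin.refl _ _⟩
  | cons b u ih =>
    obtain ⟨T₁, hn₁, hT₁, hc₁⟩ := h Q T b hn hQ hT (hu b (by simp))
    obtain ⟨T₂, hn₂, hT₂, hc₂⟩ := ih hn₁ hT₁ fun t ht => hu t (by simp [ht])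
    refine ⟨T₂, hn₂, hT₂, ?_⟩
    have := (hc₁.append he u).trans hc₂
    simpa [add_mul, add_comm] using this

/-- The letters of `S` still have to be appended, in order, to the normal word `Q`; at most the last
copy of a letter meets a full power. -/
structure Pending (F : PolycyclicPresentation m) (B : Finset (Fin m)) (Q S : PWord m) : Prop where
  left_normal : IsNormalWord F.e Q
  right_normal : IsNormalWord F.e S
  left_notMem : ∀ q ∈ Q, q ∉ B
  right_notMem : ∀ s ∈ S, s ∉ B
  le : ∀ q ∈ Q, ∀ s ∈ S, q ≤ s
  count_le : ∀ x, Q.count x + S.count x ≤ F.e x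

theorem lt_of_notMem_of_mem {B : Finset (Fin m)} (hB : IsUpperSet (B : Set (Fin m))) {a b : Fin m}
    (ha : a ∉ B) (hb : b ∈ B) : a < b := by
  by_contra! h
  exact ha (hB h hb)

/-- Appending the first pending letter takes at most one step, a power relation, and leaves the
remaining letters pending. -/
theorem Pending.next (he : ∀ i, 1 < F.e i) {A B : Finset (Fin m)}
    (hA : IsUpperSet (A : Set (Fin m))) {Q S : PWord m} {s : Fin m}
    (h : F.Pending B Q (s :: S)) (hs : s ∈ A)
    (hpow : (∃ k : Fin m, (k : ℕ) = s + 1 ∧ F.v s s = [k]) ∨ ∀ k ∈ F.v s s, k ∈ B) :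
    ∃ Q' T, F.Pending B Q' S ∧ Q'.filter (· ∉ A) = Q.filter (· ∉ A) ∧
      IsNormalWord F.e (Q' ++ T) ∧ (∀ t ∈ T, t ∈ B) ∧
      F.CollectsWithin 1 (Q ++ [s]) (Q' ++ T) := by
  have hS : IsNormalWord F.e S := h.right_normal.sublist (by simp)
  have hsS : ∀ x ∈ S, s ≤ x := (List.pairwise_cons.1 h.right_normal.1).1
  have hQs : ∀ q ∈ Q, q ≤ s := fun q hq => h.le q hq s (by simp)
  rcases normal_or_power he h.left_normal hQs with hn | ⟨Q₀, hdec, hlt, hstep⟩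
  · refine ⟨Q ++ [s], [], ⟨hn, hS, ?_, fun x hx => h.right_notMem x (by simp [hx]), ?_, ?_⟩,
      by simp [hs], by simpa using hn, by simp, by simpa using CollectsWithin.refl _ _⟩
    · intro q hq
      rcases List.mem_append.1 hq with hq | hq
      · exact h.left_notMem q hq
      · rw [List.mem_singleton.1 hq]; exact h.right_notMem s (by simp)
    · intro q hq x hx
      rcases List.mem_append.1 hq with hq | hq
      · exact h.le q hq x (by simp [hx])
      · rw [List.mem_singleton.1 hq]; exact hsS x hx
    · intro x
      have := h.count_le x
      rw [List.count_cons] at this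
      rw [List.count_append, List.count_singleton]
      omega
  · have hQ₀ : IsNormalWord F.e Q₀ := h.left_normal.sublist (by simp [hdec])
    have hQ₀B : ∀ q ∈ Q₀, q ∉ B := fun q hq => h.left_notMem q (by simp [hdec, hq])
    -- `Q` holds `e s - 1` copies of `s`, so this copy exhausts the bound of `count_le` and no `s`
    -- is left in `S`.
    have hsS' : ∀ x ∈ S, s < x := by
      have hc : S.count s = 0 := by
        have := h.count_le s
        rw [hdec] at this
        rw [List.count_append, List.count_replicate_self, List.count_cons_self] at this
        have := he s
        omega
      intro x hx
      refine lt_of_le_of_ne (hsS x hx) ?_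
      rintro rfl
      exact List.count_eq_zero.1 hc hx
    have hc0 : ∀ x, Q₀.count x + S.count x < F.e x := by
      intro x
      by_cases hx : x ∈ Q₀
      · have : x ∉ S := fun hxS => (hlt x hx).not_gt (hsS' x hxS)
        rw [List.count_eq_zero_of_not_mem this]; simpa using hQ₀.2 x
      · rw [List.count_eq_zero_of_not_mem hx]; simpa using hS.2 x
    have hvn : IsNormalWord F.e (Q₀ ++ F.v s s) :=
      hQ₀.append (F.v_normal s s le_rfl) fun a ha b hb =>
        (hlt a ha).trans (F.v_letters s s le_rfl b hb)
    have hcol := CollectsWithin.of_leftStep hstep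
    have hfil : Q₀.filter (· ∉ A) = Q.filter (· ∉ A) := by
      rw [hdec, List.filter_append, List.filter_replicate_of_neg (by simpa using hs),
        List.append_nil]
    by_cases hhigh : ∀ k ∈ F.v s s, k ∈ B
    · refine ⟨Q₀, F.v s s, ⟨hQ₀, hS, hQ₀B, fun x hx => h.right_notMem x (by simp [hx]), ?_, ?_⟩,
        hfil, hvn, hhigh, hcol⟩
      · exact fun q hq x hx => ((hlt q hq).trans (hsS' x hx)).le
      · exact fun x => (hc0 x).le
    -- The power is the next letter `k`, which is still at most every letter of `S`. By `hc0` the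
    -- count of `k` rises at most to `e k`; this is why `count_le` allows equality.
    · obtain ⟨k, hk, hv⟩ := hpow.resolve_right hhigh
      have hkB : k ∉ B := by simpa [hv] using hhigh
      have hkA : k ∈ A := hA (show s ≤ k by rw [Fin.le_def, hk]; omega) hs
      rw [hv] at hvn hcol
      refine ⟨Q₀ ++ [k], [], ⟨hvn, hS, ?_, fun x hx => h.right_notMem x (by simp [hx]), ?_, ?_⟩,
        by simpa [hkA] using hfil, by simpa using hvn, by simp, by simpa using hcol⟩
      · intro q hq
        rcases List.mem_append.1 hq with hq | hq
        · exact hQ₀B q hq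
        · rw [List.mem_singleton.1 hq]; exact hkB
      · intro q hq x hx
        rcases List.mem_append.1 hq with hq | hq
        · exact ((hlt q hq).trans (hsS' x hx)).le
        · rw [List.mem_singleton.1 hq]
          have := hsS' x hx
          rw [Fin.le_def, hk]; exact this
      · intro x
        rw [List.count_append, List.count_singleton]
        have := hc0 x
        split_ifs <;> omega

/-- `B ⊆ A` are consecutive levels of a favourable presentation in which all conjugates of letters
within the level have the form `a_j * v*`. -/
structure LevelStep (F : PolycyclicPresentation m) (A B : Finset (Fin m)) (V : ℕ) : Prop where
  upper_left : IsUpperSet (A : Set (Fin m))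
  upper_right : IsUpperSet (B : Set (Fin m))
  subset : B ⊆ A
  power : ∀ i ∈ A, i ∉ B →
    (∃ k : Fin m, (k : ℕ) = i + 1 ∧ F.v i i = [k]) ∨ ∀ k ∈ F.v i i, k ∈ B
  same : ∀ i ∈ A, ∀ j, i < j → j ∉ B → ∃ u, (∀ k ∈ u, k ∈ B) ∧ F.v i j = j :: u
  next : ∀ i ∈ A, i ∉ B → ∀ j ∈ B, (∀ k ∈ F.v i j, k ∈ B) ∧ (F.v i j).length ≤ V

theorem length_flatMap_le {α β : Type*} (T : List α) (g : α → List β) {V : ℕ}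
    (h : ∀ t ∈ T, (g t).length ≤ V) : (T.flatMap g).length ≤ T.length * V := by
  induction T with
  | nil => simp
  | cons t T ih =>
    have h1 := h t (by simp)
    have h2 := ih fun x hx => h x (by simp [hx])
    simp only [List.flatMap_cons, List.length_append, List.length_cons]
    linarith

/-- The letter `s` passes the deeper tail `T` in at most `M` steps and meets at most one power
relation; then the conjugates of `T`, at most `M * V` deeper letters, are appended for `f` steps
each. The clause on filters records that letters outside `A` are untouched. -/
theorem Pending.collect_letter (he : ∀ i, 1 < F.e i) {A B : Finset (Fin m)} {V M f : ℕ}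
    (hAB : F.LevelStep A B V) (hf : F.LetterBound B f)
    (hM : ∀ w, IsNormalWord F.e w → (∀ t ∈ w, t ∈ B) → w.length ≤ M)
    {Q S T : PWord m} {s : Fin m} (h : F.Pending B Q (s :: S)) (hs : s ∈ A)
    (hn : IsNormalWord F.e (Q ++ T)) (hT : ∀ t ∈ T, t ∈ B) :
    ∃ Q' T', F.Pending B Q' S ∧ Q'.filter (· ∉ A) = Q.filter (· ∉ A) ∧
      IsNormalWord F.e (Q' ++ T') ∧ (∀ t ∈ T', t ∈ B) ∧
      F.CollectsWithin (M + 1 + M * V * f) (Q ++ T ++ [s]) (Q' ++ T') := by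
  have hsB : s ∉ B := h.right_notMem s (by simp)
  have hTM : T.length ≤ M := hM T (hn.sublist (by simp)) hT
  have h1 := collectsWithin_moveLeft he Q T s hn
    fun t ht => lt_of_notMem_of_mem hAB.upper_right hsB (hT t ht)
  obtain ⟨Q', T₁, hp, hfil, hn₁, hT₁, h2⟩ :=
    h.next he hAB.upper_left hs (hAB.power s hs hsB)
  obtain ⟨T₂, hn₂, hT₂, h3⟩ := hf.word he (T.flatMap (F.v s)) hn₁ hp.left_notMem hT₁ (by
    intro t ht
    obtain ⟨x, hx, hx'⟩ := List.mem_flatMap.1 ht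
    exact (hAB.next s hs hsB x (hT x hx)).1 t hx')
  refine ⟨Q', T₂, hp, hfil, hn₂, hT₂, (h1.trans ((h2.append he _).trans h3)).mono ?_⟩
  have h4 : (T.flatMap (F.v s)).length ≤ M * V :=
    (length_flatMap_le T (F.v s) fun t ht => (hAB.next s hs hsB t (hT t ht)).2).trans
      (Nat.mul_le_mul_right V hTM)
  have h5 := Nat.mul_le_mul_right f h4
  omega

/-- Here `g` is conjugation by the letter being inserted. Each block `s :: u` costs one
`Pending.collect_letter`, plus `M * f` for the deeper word `u`. -/
theorem Pending.collect_blocks (he : ∀ i, 1 < F.e i) {A B : Finset (Fin m)} {V M f : ℕ}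
    (hAB : F.LevelStep A B V) (hf : F.LetterBound B f)
    (hM : ∀ w, IsNormalWord F.e w → (∀ t ∈ w, t ∈ B) → w.length ≤ M)
    {Q S T : PWord m} (g : Fin m → PWord m) (h : F.Pending B Q S) (hs : ∀ s ∈ S, s ∈ A)
    (hg : ∀ s ∈ S, ∃ u, IsNormalWord F.e u ∧ (∀ k ∈ u, k ∈ B) ∧ g s = s :: u)
    (hn : IsNormalWord F.e (Q ++ T)) (hT : ∀ t ∈ T, t ∈ B) :
    ∃ Q' T', F.Pending B Q' [] ∧ Q'.filter (· ∉ A) = Q.filter (· ∉ A) ∧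
      IsNormalWord F.e (Q' ++ T') ∧ (∀ t ∈ T', t ∈ B) ∧
      F.CollectsWithin (S.length * (M + 1 + M * V * f + M * f)) (Q ++ T ++ S.flatMap g)
        (Q' ++ T') := by
  induction S generalizing Q T with
  | nil => exact ⟨Q, T, h, rfl, hn, hT, by simpa using CollectsWithin.refl _ _⟩
  | cons s S ih =>
    obtain ⟨u, hun, huB, hu⟩ := hg s (by simp)
    obtain ⟨Q₁, T₁, hp₁, hfil₁, hn₁, hT₁, hc₁⟩ := h.collect_letter he hAB hf hM (hs s (by simp)) hn hT
    obtain ⟨T₂, hn₂, hT₂, hc₂⟩ := hf.word he u hn₁ hp₁.left_notMem hT₁ huB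
    obtain ⟨Q₃, T₃, hp₃, hfil₃, hn₃, hT₃, hc₃⟩ := ih hp₁ (fun x hx => hs x (by simp [hx]))
      (fun x hx => hg x (by simp [hx])) hn₂ hT₂
    refine ⟨Q₃, T₃, hp₃, hfil₃.trans hfil₁, hn₃, hT₃, ?_⟩
    have h1 := (((hc₁.append he u).trans hc₂).append he (S.flatMap g)).trans hc₃
    have h2 : u.length * f ≤ M * f := Nat.mul_le_mul_right f (hM u hun huB)
    have h3 := h1.mono (n' := (s :: S).length * (M + 1 + M * V * f + M * f)) (by
      rw [List.length_cons, add_mul, one_mul]; omega)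
    simpa [hu] using h3

/-- The bound for appending one letter, from one level to the previous one. -/
theorem LevelStep.letterBound (he : ∀ i, 1 < F.e i) {A B : Finset (Fin m)} {V M N f f' : ℕ}
    (hAB : F.LevelStep A B V) (hf : F.LetterBound B f)
    (hM : ∀ w, IsNormalWord F.e w → (∀ t ∈ w, t ∈ B) → w.length ≤ M)
    (hN : ∀ i ∈ A, i ∉ B → ∀ w, IsNormalWord F.e w →
      (∀ t ∈ w, t ∈ A ∧ t ∉ B ∧ i < t) → w.length ≤ N)
    (hff' : f ≤ f')
    (hf' : (∃ i ∈ A, i ∉ B) → N + M + 1 + N * (M + 1 + M * V * f + M * f) + M * V * f ≤ f') :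
    F.LetterBound A f' := by
  intro Q T i hn hQ hT hi
  -- A letter of `B` is handled by the deeper bound, with the letters of `T` outside `B` counted
  -- among the untouched ones.
  by_cases hiB : i ∈ B
  · have hdec := List.eq_filter_append_of_isUpperSet
      (hn.sublist (List.sublist_append_right Q T)).1 hAB.upper_right
    set T₁ := T.filter (· ∉ B) with hT₁
    set T₂ := T.filter (· ∈ B) with hT₂
    obtain ⟨T', hn', hT', hc⟩ := hf (Q ++ T₁) T₂ i (by rw [List.append_assoc, ← hdec]; exact hn)
      (by
        intro q hq
        rcases List.mem_append.1 hq with hq | hq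
        · exact fun h => hQ q hq (hAB.subset h)
        · simp [hT₁] at hq; exact hq.2)
      (by intro t ht; simp [hT₂] at ht; exact ht.2) hiB
    refine ⟨T₁ ++ T', by simpa using hn', ?_, ?_⟩
    · intro t ht
      rcases List.mem_append.1 ht with ht | ht
      · simp [hT₁] at ht; exact hT t ht.1
      · exact hAB.subset (hT' t ht)
    · rw [List.append_assoc Q T₁ T₂, ← hdec] at hc
      simpa using hc.mono hff'
  · replace hf' := hf' ⟨i, hi, hiB⟩
    have hTn : IsNormalWord F.e T := hn.sublist (List.sublist_append_right Q T)
    have hU : IsUpperSet ((Finset.univ.filter (i < ·) : Finset (Fin m)) : Set (Fin m)) := by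
      intro a b hab ha
      simp at ha ⊢
      exact ha.trans_le hab
    have hdec := List.eq_filter_append_of_isUpperSet hTn.1 hU
    -- `T = P ++ R`, where `i` has to pass exactly `R`; and `R = S ++ W` with `S` in the level of
    -- `i` and `W` deeper.
    set P := T.filter (· ∉ Finset.univ.filter (i < ·)) with hP
    set R := T.filter (· ∈ Finset.univ.filter (i < ·)) with hR
    have hRn : IsNormalWord F.e R := hTn.sublist (by simp [hR])
    have hdec' := List.eq_filter_append_of_isUpperSet hRn.1 hAB.upper_right
    set S := R.filter (· ∉ B) with hS
    set W := R.filter (· ∈ B) with hW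
    have hPi : ∀ x ∈ P, x ≤ i := by intro x hx; simp [hP] at hx; exact hx.2
    have hPT : ∀ x ∈ P, x ∈ T := by intro x hx; simp [hP] at hx; exact hx.1
    have hRi : ∀ x ∈ R, i < x := by intro x hx; simp [hR] at hx; exact hx.2
    have hRT : ∀ x ∈ R, x ∈ T := by intro x hx; simp [hR] at hx; exact hx.1
    have hSR : ∀ x ∈ S, x ∈ R ∧ x ∉ B := by intro x hx; simpa [hS] using hx
    have hWR : ∀ x ∈ W, x ∈ R ∧ x ∈ B := by intro x hx; simpa [hW] using hx
    have hSn : IsNormalWord F.e S := hRn.sublist (by simp [hS])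
    have hWn : IsNormalWord F.e W := hRn.sublist (by simp [hW])
    have hQi : ∀ q ∈ Q, q < i := fun q hq => lt_of_notMem_of_mem hAB.upper_left (hQ q hq) hi
    have hQP : IsNormalWord F.e (Q ++ P) := hn.sublist (by rw [hdec]; simp)
    have hmem : ∀ q ∈ Q ++ P, q ≤ i := by
      intro q hq
      rcases List.mem_append.1 hq with hq | hq
      · exact (hQi q hq).le
      · exact hPi q hq
    -- After the move, `i` and then the heads of the conjugates of `S`, which are the letters of `S`
    -- again, have to be appended to `Q ++ P`. Only `i` can already occur in `Q ++ P`, and it is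
    -- absent from `S`; hence the bound on counts.
    have hpend : F.Pending B (Q ++ P) (i :: S) := by
      refine ⟨hQP, (isNormalWord_singleton he i).append hSn ?_, ?_, ?_, ?_, ?_⟩
      · intro a ha b hb
        rw [List.mem_singleton.1 ha]
        exact hRi b (hSR b hb).1
      · exact fun q hq hqB => hiB (hAB.upper_right (hmem q hq) hqB)
      · intro s hs
        rcases List.mem_cons.1 hs with rfl | hs
        · exact hiB
        · exact (hSR s hs).2
      · intro q hq s hs
        rcases List.mem_cons.1 hs with rfl | hs
        · exact hmem q hq
        · exact (hmem q hq).trans (hRi s (hSR s hs).1).le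
      · intro x
        have h1 := hQP.2 x
        have h2 := hSn.2 x
        rw [List.count_cons]
        by_cases hx : x ∈ S
        · have h3 : i < x := hRi x (hSR x hx).1
          have h4 : x ∉ Q ++ P := fun hx' => (hmem x hx').not_gt h3
          rw [List.count_eq_zero_of_not_mem h4]
          split_ifs <;> omega
        · rw [List.count_eq_zero_of_not_mem hx]
          split_ifs <;> omega
    have hc₁ := collectsWithin_moveLeft he (Q ++ P) R i
      (by rw [List.append_assoc, ← hdec]; exact hn) hRi
    obtain ⟨Q₁, T₁, hp₁, hfil₁, hn₁, hT₁, hc₂⟩ :=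
      hpend.next he hAB.upper_left hi (hAB.power i hi hiB)
    obtain ⟨Q₂, T₂, hp₂, hfil₂, hn₂, hT₂, hc₃⟩ := hp₁.collect_blocks he hAB hf hM (F.v i)
      (fun s hs => hT s (hRT s (hSR s hs).1)) (fun s hs => by
        obtain ⟨u, hu, huv⟩ := hAB.same i hi s (hRi s (hSR s hs).1) (hSR s hs).2
        refine ⟨u, (F.v_normal i s (hRi s (hSR s hs).1).le).sublist (by simp [huv]), hu, huv⟩)
      hn₁ hT₁
    obtain ⟨T₃, hn₃, hT₃, hc₄⟩ := hf.word he (W.flatMap (F.v i)) hn₂ hp₂.left_notMem hT₂ (by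
      intro t ht
      obtain ⟨x, hx, hx'⟩ := List.mem_flatMap.1 ht
      exact (hAB.next i hi hiB x (hWR x hx).2).1 t hx')
    have hSA : ∀ s ∈ S, s ∈ A := fun s hs => hT s (hRT s (hSR s hs).1)
    have hlS : S.length ≤ N := hN i hi hiB S hSn
      fun t ht => ⟨hSA t ht, (hSR t ht).2, hRi t (hSR t ht).1⟩
    have hlW : W.length ≤ M := hM W hWn fun t ht => (hWR t ht).2
    have hlR : R.length = S.length + W.length := by rw [hdec', List.length_append]
    -- The part of the result outside `A` is still `Q`, so the result splits as the required `Q ++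
    -- T'`.
    have hfil : (Q₂ ++ T₃).filter (· ∉ A) = Q := by
      have h1 : T₃.filter (· ∉ A) = [] := by
        rw [List.filter_eq_nil_iff]; intro b hb; simpa using hAB.subset (hT₃ b hb)
      have h2 : P.filter (· ∉ A) = [] := by
        rw [List.filter_eq_nil_iff]; intro b hb; simpa using hT b (hPT b hb)
      have h3 : Q.filter (· ∉ A) = Q := by
        rw [List.filter_eq_self]; intro b hb; simpa using hQ b hb
      rw [List.filter_append, h1, hfil₂, hfil₁, List.filter_append, h2, h3]; simp
    have hdec₃ := List.eq_filter_append_of_isUpperSet hn₃.1 hAB.upper_left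
    rw [hfil] at hdec₃
    refine ⟨(Q₂ ++ T₃).filter (· ∈ A), hdec₃ ▸ hn₃,
      fun t ht => by simpa using (List.mem_filter.1 ht).2,
      ?_⟩
    rw [← hdec₃]
    have hfl : R.flatMap (F.v i) = S.flatMap (F.v i) ++ W.flatMap (F.v i) := by
      rw [← List.flatMap_append, ← hdec']
    rw [hfl] at hc₁
    have h0 := (((hc₂.append he (S.flatMap (F.v i))).trans hc₃).append he
      (W.flatMap (F.v i))).trans hc₄
    rw [List.append_assoc _ (S.flatMap _) (W.flatMap _)] at h0
    have h1 := hc₁.trans h0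
    rw [List.append_assoc Q P R, ← hdec] at h1
    -- The costs are: `N + M` swaps for `i`, one power relation, at most `N` blocks from `S`, and at
    -- most `M * V` deeper letters from `W`.
    refine h1.mono (le_trans ?_ hf')
    have h2 : (W.flatMap (F.v i)).length ≤ M * V :=
      (length_flatMap_le W (F.v i) fun t ht => (hAB.next i hi hiB t (hWR t ht).2).2).trans
        (Nat.mul_le_mul_right V hlW)
    have h3 := Nat.mul_le_mul_right f h2
    have h4 := Nat.mul_le_mul_right (M + 1 + M * V * f + M * f) hlS
    omega

end PolycyclicPresentation

/-! ### The lower central series -/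

section LowerCentral

variable {G : Type*} [Group G]

open Subgroup

/-- The three subgroups lemma, applied in the quotient by `N`. -/
theorem Subgroup.commutator_commutator_le_of_rotate {H₁ H₂ H₃ N : Subgroup G} [N.Normal]
    (h1 : ⁅⁅H₂, H₃⁆, H₁⁆ ≤ N) (h2 : ⁅⁅H₃, H₁⁆, H₂⁆ ≤ N) : ⁅⁅H₁, H₂⁆, H₃⁆ ≤ N := by
  have key : ∀ K : Subgroup G, K.map (QuotientGroup.mk' N) = ⊥ ↔ K ≤ N := fun K => by
    rw [Subgroup.map_eq_bot_iff, QuotientGroup.ker_mk']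
  rw [← key] at h1 h2 ⊢
  simp only [Subgroup.map_commutator] at h1 h2 ⊢
  exact commutator_commutator_eq_bot_of_rotate h1 h2

/-- This is [γ_{a+1}, γ_{b+1}] ≤ γ_{a+b+2}: the indexing starts at 0, whence the additional 1. The
induction step is the three subgroups lemma with the whole group as one of the three. -/
theorem Subgroup.commutator_lowerCentralSeries_le (a b : ℕ) :
    ⁅(⊤ : Subgroup G).lowerCentralSeries a, (⊤ : Subgroup G).lowerCentralSeries b⁆ ≤
      (⊤ : Subgroup G).lowerCentralSeries (a + b + 1) := by
  induction b generalizing a with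
  | zero => simp
  | succ b ih =>
    rw [lowerCentralSeries_succ, commutator_comm]
    refine commutator_commutator_le_of_rotate ?_ ?_
    · rw [commutator_comm ⊤, ← lowerCentralSeries_succ]
      refine (ih (a + 1)).trans (le_of_eq ?_)
      congr 1; omega
    · exact (commutator_mono (ih a) le_rfl).trans (le_of_eq rfl)

/-- In a group of order `p ^ n`, the lower central series reaches a subgroup of order at most
`p ^ (n - j)` after `j` steps. -/
theorem Subgroup.card_lowerCentralSeries_mul_le {p n : ℕ} [hp : Fact p.Prime] [Finite G]
    (hG : Nat.card G = p ^ n) (j : ℕ) (hj : (⊤ : Subgroup G).lowerCentralSeries j ≠ ⊥) :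
    Nat.card ((⊤ : Subgroup G).lowerCentralSeries j) * p ^ j ≤ p ^ n := by
  have hpG : IsPGroup p G := .of_card hG
  have : Group.IsNilpotent G := hpG.isNilpotent
  induction j with
  | zero => simp [hG]
  | succ j ih =>
    set H := (⊤ : Subgroup G).lowerCentralSeries j with hH
    set K := (⊤ : Subgroup G).lowerCentralSeries (j + 1) with hK
    have hle : K ≤ H := lowerCentralSeries_antitone _ (Nat.le_succ j)
    -- If two consecutive terms agree, the series is constant from there on, and nilpotency makes it
    -- trivial.
    have hne : K ≠ H := by
      intro h
      have hall : ∀ i, (⊤ : Subgroup G).lowerCentralSeries (j + i) = H := by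
        intro i
        induction i with
        | zero => rfl
        | succ i ih' => rw [← add_assoc, lowerCentralSeries_succ, ih', ← h]; rw [h]; exact h
      obtain ⟨c, hc⟩ := nilpotent_iff_lowerCentralSeries.1 this
      have h1 : H ≤ ⊥ := by
        rw [← hall c, ← hc]; exact lowerCentralSeries_antitone _ (Nat.le_add_left c j)
      exact hj (le_bot_iff.1 (hle.trans h1))
    have hHb : H ≠ ⊥ := fun h => hj (le_bot_iff.1 (h ▸ hle))
    have hlt : K < H := lt_of_le_of_ne hle hne
    obtain ⟨s, hs⟩ := IsPGroup.iff_card.1 (hpG.to_subgroup H)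
    obtain ⟨t, ht⟩ := IsPGroup.iff_card.1 (hpG.to_subgroup K)
    have hcard : Nat.card K < Nat.card H := by
      exact Set.ncard_lt_ncard (s := (K : Set G)) (t := (H : Set G)) hlt (Set.toFinite _)
    have h1 := ih hHb
    rw [hs] at h1 hcard
    rw [ht] at hcard ⊢
    have hst : t < s := (Nat.pow_lt_pow_iff_right hp.1.one_lt).1 hcard
    calc p ^ t * p ^ (j + 1) = p ^ (t + 1) * p ^ j := by ring
      _ ≤ p ^ s * p ^ j := Nat.mul_le_mul_right _ (Nat.pow_le_pow_right hp.1.pos hst)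
      _ ≤ p ^ n := h1

theorem Subgroup.lt_of_lowerCentralSeries_ne_bot {p n : ℕ} [hp : Fact p.Prime] [Finite G]
    (hG : Nat.card G = p ^ n) {j : ℕ} (hj : (⊤ : Subgroup G).lowerCentralSeries j ≠ ⊥) :
    j < n := by
  have h1 := card_lowerCentralSeries_mul_le hG j hj
  have h2 : 1 < Nat.card ((⊤ : Subgroup G).lowerCentralSeries j) :=
    (Subgroup.one_lt_card_iff_ne_bot _).2 hj
  have h3 : p ^ j < p ^ n := by
    have := Nat.pow_pos (n := j) hp.1.pos
    nlinarith
  exact (Nat.pow_lt_pow_iff_right hp.1.one_lt).1 h3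

end LowerCentral

/-! ### Generating sequences refining a series with abelian factors -/

section GeneratingSequence

variable {G : Type*} [Group G]

/-- `GenSeq p L as H` says that `as` is a sequence of generators of `H` whose tails generate a
subnormal series of `H` that refines the series `L`, such that the `p`-th power of each generator
is the next one or lies in the next term of `L`. -/
inductive GenSeq (p : ℕ) (L : ℕ → Subgroup G) : List G → Subgroup G → Prop
  | nil : GenSeq p L [] ⊥
  | cons {as : List G} {H : Subgroup G} (k : ℕ) (b : G) : GenSeq p L as H → L (k + 1) ≤ H →
      H ≤ L k → b ∈ L k → b ∉ H → b ^ p ∈ H → (b ^ p ∈ L (k + 1) ∨ as.head? = some (b ^ p)) →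
      GenSeq p L (b :: as) (H ⊔ Subgroup.zpowers b)

/-- Commutators of `b` with `H` lie in `L₁ ≤ H`, so `b` normalizes `H` and the join is a product
set. -/
theorem mem_sup_zpowers_iff {L₀ L₁ H : Subgroup G} (hL : ⁅L₀, L₀⁆ ≤ L₁) (h1 : L₁ ≤ H)
    (h0 : H ≤ L₀) {b : G} (hb : b ∈ L₀) {x : G} :
    x ∈ H ⊔ Subgroup.zpowers b ↔ ∃ z : ℤ, ∃ h ∈ H, x = b ^ z * h := by
  have hn : Subgroup.zpowers b ≤ Subgroup.normalizer (H : Set G) := by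
    rw [Subgroup.le_normalizer_iff_commutator_le_left]
    exact (Subgroup.commutator_mono h0 (by simpa using hb)).trans (hL.trans h1)
  rw [sup_comm, ← SetLike.mem_coe, Subgroup.coe_mul_of_left_le_normalizer_right _ _ hn, Set.mem_mul]
  constructor
  · rintro ⟨y, ⟨z, rfl⟩, h, hh, rfl⟩; exact ⟨z, h, hh, rfl⟩
  · rintro ⟨z, h, hh, rfl⟩; exact ⟨b ^ z, ⟨z, rfl⟩, h, hh, rfl⟩

variable {p : ℕ} {L : ℕ → Subgroup G}

/-- A cyclic factor of order `p ^ n` contributes g, g^p, …, g^{p^(n-1)}, each generator being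
followed by its own p-th power; the p-th power of the last one falls into `L (k + 1)`. For `n = 0`
nothing is added. -/
theorem GenSeq.exists_cyclic (hL : ∀ k, ⁅L k, L k⁆ ≤ L (k + 1)) (k n : ℕ)
    (hp : p.Prime) {as : List G} {H : Subgroup G} (h : GenSeq p L as H) (h1 : L (k + 1) ≤ H)
    (h0 : H ≤ L k) (g : G) (hg : g ∈ L k) (hgn : g ^ p ^ n ∈ L (k + 1))
    (hz : ∀ z : ℤ, g ^ z ∈ H → (p ^ n : ℤ) ∣ z) :
    ∃ as', GenSeq p L as' (H ⊔ Subgroup.zpowers g) ∧ (n = 0 ∨ as'.head? = some g) := by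
  induction n generalizing g with
  | zero =>
    refine ⟨as, ?_, .inl rfl⟩
    rwa [sup_eq_left.2]
    simpa using h1 (by simpa using hgn)
  | succ n ih =>
    obtain ⟨as', has', hd⟩ := ih (g ^ p) (pow_mem hg p) (by rwa [← pow_mul, ← pow_succ'])
      (fun z hz' => by
        have h2 := hz (p * z) (by rwa [zpow_mul, zpow_natCast])
        rw [pow_succ'] at h2
        exact Int.dvd_of_mul_dvd_mul_left (by exact_mod_cast hp.ne_zero) h2)
    refine ⟨g :: as', ?_, .inr rfl⟩
    have h3 : H ⊔ Subgroup.zpowers g =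
        (H ⊔ Subgroup.zpowers (g ^ p)) ⊔ Subgroup.zpowers g := by
      have h4 : Subgroup.zpowers (g ^ p) ≤ Subgroup.zpowers g := by
        simp
      rw [sup_assoc, sup_eq_right.2 h4]
    rw [h3]
    refine .cons k g has' (h1.trans le_sup_left) (sup_le h0 (by simpa using pow_mem hg p)) hg ?_
      ((le_sup_right : _ ≤ H ⊔ Subgroup.zpowers (g ^ p)) (Subgroup.mem_zpowers _)) ?_
    · intro hmem
      obtain ⟨z, x, hx, hgx⟩ := (mem_sup_zpowers_iff (hL k) h1 h0 (pow_mem hg p)).1 hmem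
      -- If `g` were in the product of `H` and the powers of `g ^ p`, then `p` would divide an
      -- exponent of the form 1 - pz.
      have h4 : g ^ (1 - (p : ℤ) * z) ∈ H := by
        have : g ^ (1 - (p : ℤ) * z) = x := by
          rw [sub_eq_neg_add, zpow_add, zpow_one, zpow_neg, zpow_mul, zpow_natCast]
          exact inv_mul_eq_of_eq_mul hgx
        rwa [this]
      have h5 := hz _ h4
      have h6 : (p : ℤ) ∣ 1 := by
        have h7 : (p : ℤ) ∣ 1 - p * z := (Dvd.intro_left _ (pow_succ (p : ℤ) n).symm).trans h5
        simpa using dvd_add h7 (Dvd.intro z rfl)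
      exact hp.one_lt.ne' (by exact_mod_cast Int.eq_one_of_dvd_one (by positivity) h6)
    · rcases hd with rfl | hd
      · left; simpa using hgn
      · exact .inr hd

/-- The cyclic factors of the abelian quotient are added one at a time: `H s` consists of the
elements of `L k` whose coordinates outside `s` vanish. -/
theorem GenSeq.exists_of_pi (hL : ∀ k, ⁅L k, L k⁆ ≤ L (k + 1)) (hle : ∀ k, L (k + 1) ≤ L k)
    (hp : p.Prime) (hG : IsPGroup p G)
    (k : ℕ) {as : List G} (h : GenSeq p L as (L (k + 1))) {ι : Type*} [Fintype ι] {n : ι → ℕ}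
    (φ : L k →* ((i : ι) → Multiplicative (ZMod (n i)))) (hφ : Function.Surjective φ)
    (hker : φ.ker = (L (k + 1)).subgroupOf (L k)) : ∃ as', GenSeq p L as' (L k) := by
  classical
  let H : Finset ι → Subgroup G := fun s =>
    (⨅ i ∈ (sᶜ : Finset ι), ((Pi.evalMonoidHom _ i).comp φ).ker).map (L k).subtype
  have hH : ∀ s x, x ∈ H s ↔ ∃ hx : x ∈ L k, ∀ i ∉ s, φ ⟨x, hx⟩ i = 1 := by
    intro s x
    simp [H, Subgroup.mem_iInf, MonoidHom.mem_ker]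
  have hbase : H ∅ = L (k + 1) := by
    ext x
    rw [hH]
    constructor
    · rintro ⟨hx, h1⟩
      have : (⟨x, hx⟩ : L k) ∈ φ.ker := MonoidHom.mem_ker.2 (funext fun i => h1 i (by simp))
      rwa [hker] at this
    · intro hx
      refine ⟨hle k hx, fun i _ => ?_⟩
      have : (⟨x, hle k hx⟩ : L k) ∈ φ.ker := by rw [hker]; exact hx
      rw [MonoidHom.mem_ker.1 this]; rfl
  have htop : H Finset.univ = L k := by
    ext x; rw [hH]; simp
  suffices hs : ∀ s : Finset ι, ∃ as', GenSeq p L as' (H s) by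
    obtain ⟨as', h'⟩ := hs Finset.univ
    exact ⟨as', htop ▸ h'⟩
  intro s
  induction s using Finset.induction_on with
  | empty => exact ⟨as, hbase ▸ h⟩
  | insert i s hi ih =>
    obtain ⟨as₁, has₁⟩ := ih
    obtain ⟨⟨g, hg⟩, hgφ⟩ := hφ (Pi.mulSingle i (Multiplicative.ofAdd 1))
    have hpow : ∀ z : ℤ, φ ⟨g ^ z, zpow_mem hg z⟩ =
        Pi.mulSingle i (Multiplicative.ofAdd (z : ZMod (n i))) := by
      intro z
      have : (⟨g ^ z, zpow_mem hg z⟩ : L k) = ⟨g, hg⟩ ^ z := rfl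
      rw [this, map_zpow, hgφ, ← Pi.mulSingle_zpow, ← ofAdd_zsmul]
      simp
    -- The order of the factor divides that of its lifted generator `g`, a power of `p`.
    obtain ⟨N, hN⟩ : ∃ N, n i = p ^ N := by
      obtain ⟨M, hM⟩ := hG g
      have h1 := hpow (p ^ M : ℕ)
      have h2 : (⟨g ^ ((p ^ M : ℕ) : ℤ), zpow_mem hg _⟩ : L k) = 1 :=
        Subtype.ext ((zpow_natCast g _).trans hM)
      rw [h2, map_one] at h1
      have h3 := congrFun h1 i
      rw [Pi.mulSingle_eq_same] at h3
      have h4 : ((p ^ M : ℕ) : ZMod (n i)) = 0 := by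
        have := congrArg Multiplicative.toAdd h3
        simpa using this.symm
      obtain ⟨N, -, hN⟩ := (Nat.dvd_prime_pow hp).1 ((ZMod.natCast_eq_zero_iff _ _).1 h4)
      exact ⟨N, hN⟩
    have h1 : L (k + 1) ≤ H s := by
      rw [← hbase]
      intro x hx
      rw [hH] at hx ⊢
      exact ⟨hx.1, fun j _ => hx.2 j (by simp)⟩
    have h0 : H s ≤ L k := fun x hx => ((hH s x).1 hx).1
    have hgn : g ^ p ^ N ∈ L (k + 1) := by
      rw [← hbase, hH]
      refine ⟨pow_mem hg _, fun j _ => ?_⟩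
      have h2 := hpow (p ^ N : ℕ)
      have h3 : (((p ^ N : ℕ) : ℤ) : ZMod (n i)) = 0 := by
        rw [← hN]; simp
      rw [h3, ofAdd_zero, Pi.mulSingle_one] at h2
      simp only [zpow_natCast] at h2
      rw [h2]; rfl
    have hz : ∀ z : ℤ, g ^ z ∈ H s → (p ^ N : ℤ) ∣ z := by
      intro z hz
      obtain ⟨hx, h2⟩ := (hH s _).1 hz
      have h3 := h2 i hi
      rw [hpow z, Pi.mulSingle_eq_same] at h3
      have h4 : (z : ZMod (n i)) = 0 := congrArg Multiplicative.toAdd h3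
      have h5 := (ZMod.intCast_zmod_eq_zero_iff_dvd z (n i)).1 h4
      rw [hN] at h5
      exact_mod_cast h5
    obtain ⟨as₂, has₂, -⟩ := has₁.exists_cyclic hL k N hp h1 h0 g hg hgn hz
    refine ⟨as₂, ?_⟩
    have heq : H (insert i s) = H s ⊔ Subgroup.zpowers g := by
      ext x
      rw [mem_sup_zpowers_iff (hL k) h1 h0 hg, hH]
      constructor
      · rintro ⟨hx, h2⟩
        obtain ⟨z, hzz⟩ := ZMod.intCast_surjective (Multiplicative.toAdd (φ ⟨x, hx⟩ i))
        refine ⟨z, (g ^ z)⁻¹ * x, (hH _ _).2 ⟨mul_mem (inv_mem (zpow_mem hg z)) hx, fun j hj => ?_⟩,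
          by group⟩
        have h3 : (⟨(g ^ z)⁻¹ * x, mul_mem (inv_mem (zpow_mem hg z)) hx⟩ : L k) =
          (⟨g ^ z, zpow_mem hg z⟩)⁻¹ * ⟨x, hx⟩ := rfl
        rw [h3, map_mul, map_inv, hpow, Pi.mul_apply, Pi.inv_apply]
        by_cases hji : j = i
        · subst hji
          rw [Pi.mulSingle_eq_same, hzz]; simp
        · rw [Pi.mulSingle_eq_of_ne hji, h2 j (by simp [hji, hj])]; simp
      · rintro ⟨z, y, hy, rfl⟩
        obtain ⟨hy0, hy1⟩ := (hH _ _).1 hy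
        refine ⟨mul_mem (zpow_mem hg z) hy0, fun j hj => ?_⟩
        rw [Finset.mem_insert, not_or] at hj
        have h3 : (⟨g ^ z * y, mul_mem (zpow_mem hg z) hy0⟩ : L k) =
          ⟨g ^ z, zpow_mem hg z⟩ * ⟨y, hy0⟩ := rfl
        rw [h3, map_mul, hpow, Pi.mul_apply, Pi.mulSingle_eq_of_ne hj.1, hy1 j hj.2, one_mul]
    rw [heq]
    exact has₂

theorem GenSeq.exists_of_series [Finite G] (hL : ∀ k, ⁅L k, L k⁆ ≤ L (k + 1))
    (hle : ∀ k, L (k + 1) ≤ L k) (hnorm : ∀ k, (L k).Normal) (hp : p.Prime) (hG : IsPGroup p G)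
    {D : ℕ} (hD : L D = ⊥) {k : ℕ} (hk : k ≤ D) : ∃ as, GenSeq p L as (L k) := by
  induction hk using Nat.decreasingInduction with
  | self => exact ⟨[], hD ▸ .nil⟩
  | of_succ k hk ih =>
    obtain ⟨as, has⟩ := ih
    have := hnorm (k + 1)
    let N := (L (k + 1)).subgroupOf (L k)
    have hN : _root_.commutator (L k) ≤ N := by
      rw [_root_.commutator_def, Subgroup.commutator_le]
      intro x _ y _
      exact hL k (Subgroup.commutator_mem_commutator x.2 y.2)
    let _ : CommGroup (L k ⧸ N) :=
      { (inferInstance : Group (L k ⧸ N)) with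
        mul_comm := by
          have := (Subgroup.Normal.quotient_commutative_iff_commutator_le (N := N)).2 hN
          exact this.is_comm.comm }
    obtain ⟨ι, _, n, -, ⟨e⟩⟩ := CommGroup.equiv_prod_multiplicative_zmod_of_finite (L k ⧸ N)
    refine has.exists_of_pi hL hle hp hG k (e.toMonoidHom.comp (QuotientGroup.mk' N))
      (e.surjective.comp (QuotientGroup.mk'_surjective N)) ?_
    ext x
    simp [N]

end GeneratingSequence

/-! ### Bases adapted to the series -/

section LevelBasis

variable {G : Type*} [Group G] {p : ℕ} {L : ℕ → Subgroup G}

/-- A sequence of generators of a group of order `p ^ m` adapted to the series `L`. -/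
structure LevelBasis (p : ℕ) (L : ℕ → Subgroup G) {m : ℕ} (a : Fin m → G) : Prop where
  card : Nat.card G = p ^ m
  upper : ∀ k i j, i ≤ j → a i ∈ L k → a j ∈ L k
  level : ∀ i, ∃ k, a i ∈ L k ∧ a i ∉ L (k + 1) ∧
    (a i ^ p ∈ L (k + 1) ∨ ∃ j : Fin m, (j : ℕ) = i + 1 ∧ a i ^ p = a j)
  exists_word : ∀ k, ∀ x ∈ L k, ∃ w : PWord m,
    IsNormalWord (fun _ => p) w ∧ (∀ i ∈ w, a i ∈ L k) ∧ (w.map a).prod = x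

theorem GenSeq.mem_of_mem {as : List G} {H : Subgroup G} (h : GenSeq p L as H) :
    ∀ x ∈ as, x ∈ H := by
  induction h with
  | nil => simp
  | cons k b h _ _ _ _ _ _ ih =>
    intro x hx
    rcases List.mem_cons.1 hx with rfl | hx
    · exact (le_sup_right : _ ≤ _ ⊔ Subgroup.zpowers x) (Subgroup.mem_zpowers _)
    · exact (le_sup_left : _ ≤ _ ⊔ Subgroup.zpowers b) (ih x hx)

theorem GenSeq.exists_drop {as : List G} {H : Subgroup G} (h : GenSeq p L as H) (i : ℕ) :
    ∃ H', GenSeq p L (as.drop i) H' := by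
  induction h generalizing i with
  | nil => exact ⟨⊥, by simpa using .nil⟩
  | cons k b h h1 h0 hb hb' hp hd ih =>
    cases i with
    | zero => exact ⟨_, .cons k b h h1 h0 hb hb' hp hd⟩
    | succ i => simpa using ih i

/-- Generators are dropped while their level is less than `k`; at the first one of level at least
`k` the remaining tail generates exactly `L k`. -/
theorem GenSeq.exists_drop_eq (hle : Antitone L) {as : List G} {H : Subgroup G}
    (h : GenSeq p L as H) {k : ℕ} (hk : L k ≤ H) : ∃ i, GenSeq p L (as.drop i) (L k) := by
  induction h with
  | nil => exact ⟨0, by rw [le_bot_iff.1 hk]; simpa using .nil⟩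
  | @cons as H k₀ b h h1 h0 hb hb' hp hd ih =>
    rcases lt_or_ge k₀ k with hlt | hge
    · obtain ⟨i, hi⟩ := ih ((hle hlt).trans h1)
      exact ⟨i + 1, by simpa using hi⟩
    · have : L k = H ⊔ Subgroup.zpowers b :=
        le_antisymm hk ((sup_le h0 (by simpa using hb)).trans (hle hge))
      exact ⟨0, this ▸ .cons k₀ b h h1 h0 hb hb' hp hd⟩

/-- The level of a generator is determined by the series: `b` avoids the subgroup generated by the
rest, which contains `L (k₀ + 1)`. -/
theorem GenSeq.le_of_mem (hle : Antitone L) {as : List G} {b : G} {H : Subgroup G}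
    (h : GenSeq p L (b :: as) H) {k : ℕ} (hk : b ∈ L k) : H ≤ L k := by
  cases h with
  | cons k₀ b h h1 h0 hb hb' hp hd =>
    have : k ≤ k₀ := by
      by_contra! hlt
      exact hb' (h1 (hle hlt hk))
    exact (sup_le h0 (by simpa using hb)).trans (hle this)

theorem exists_pow_mul_of_mem_sup (hp : 0 < p) {L₀ L₁ H : Subgroup G} (hL : ⁅L₀, L₀⁆ ≤ L₁)
    (h1 : L₁ ≤ H) (h0 : H ≤ L₀) {b : G} (hb : b ∈ L₀) (hbp : b ^ p ∈ H) {x : G}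
    (hx : x ∈ H ⊔ Subgroup.zpowers b) : ∃ c < p, ∃ h ∈ H, x = b ^ c * h := by
  obtain ⟨z, h, hh, rfl⟩ := (mem_sup_zpowers_iff hL h1 h0 hb).1 hx
  have hpz : (0 : ℤ) < p := by exact_mod_cast hp
  refine ⟨(z % p).toNat, ?_, (b ^ p) ^ (z / p) * h, mul_mem (zpow_mem hbp _) hh, ?_⟩
  · have := Int.emod_lt_of_pos z hpz
    have := Int.emod_nonneg z hpz.ne'
    omega
  · have h2 : b ^ (z % p).toNat = b ^ (z % p) := by
      rw [← zpow_natCast, Int.toNat_of_nonneg (Int.emod_nonneg z hpz.ne')]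
    rw [h2, ← mul_assoc, ← zpow_natCast b p, ← zpow_mul, ← zpow_add, Int.emod_add_mul_ediv]

/-- Each new generator enlarges the subgroup strictly and at most by the factor `p`; orders are
powers of `p`, so the factor is `p`. -/
theorem GenSeq.card [Finite G] (hL : ∀ k, ⁅L k, L k⁆ ≤ L (k + 1)) (hp : p.Prime)
    (hG : IsPGroup p G) {as : List G} {H : Subgroup G} (h : GenSeq p L as H) :
    Nat.card H = p ^ as.length := by
  have := Fact.mk hp
  induction h with
  | nil => simp
  | @cons as H k b h h1 h0 hb hb' hbp hd ih =>
    set K := H ⊔ Subgroup.zpowers b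
    obtain ⟨s, hs⟩ := IsPGroup.iff_card.1 (hG.to_subgroup K)
    have hlt : H < K := lt_of_le_of_ne le_sup_left fun h' => hb' (by
      rw [h']; exact (le_sup_right : _ ≤ H ⊔ Subgroup.zpowers b) (Subgroup.mem_zpowers _))
    have hcard : Nat.card H < Nat.card K :=
      Set.ncard_lt_ncard (s := (H : Set G)) (t := (K : Set G)) hlt (Set.toFinite _)
    have hsurj : Nat.card K ≤ Nat.card (Fin p × H) := by
      refine Nat.card_le_card_of_surjective (fun y : Fin p × H =>
        (⟨b ^ (y.1 : ℕ) * y.2, mul_mem ((le_sup_right : _ ≤ H ⊔ Subgroup.zpowers b)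
          (Subgroup.npow_mem_zpowers b _)) (hlt.le y.2.2)⟩ : K)) ?_
      rintro ⟨x, hx⟩
      obtain ⟨c, hc, y, hy, rfl⟩ := exists_pow_mul_of_mem_sup hp.pos (hL k) h1 h0 hb hbp hx
      exact ⟨(⟨c, hc⟩, ⟨y, hy⟩), rfl⟩
    rw [Nat.card_prod, Nat.card_fin, ih, ← pow_succ', hs] at hsurj
    rw [ih, hs] at hcard
    have h3 := (Nat.pow_lt_pow_iff_right hp.one_lt).1 hcard
    have h4 := (Nat.pow_le_pow_iff_right hp.one_lt).1 hsurj
    rw [hs, List.length_cons]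
    congr 1; omega

theorem GenSeq.exists_word (hL : ∀ k, ⁅L k, L k⁆ ≤ L (k + 1)) (hp : p.Prime) {as : List G}
    {i : ℕ} (hi : i ≤ as.length) {H : Subgroup G} (h : GenSeq p L (as.drop i) H) {x : G}
    (hx : x ∈ H) : ∃ w : PWord as.length, IsNormalWord (fun _ => p) w ∧
      (∀ j ∈ w, i ≤ j) ∧ (w.map as.get).prod = x := by
  induction hi using Nat.decreasingInduction generalizing H x with
  | self =>
    rw [List.drop_length] at h
    cases h
    rw [Subgroup.mem_bot] at hx
    exact ⟨[], isNormalWord_nil fun _ => hp.pos, by simp, by simp [hx]⟩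
  | of_succ i hi ih =>
    rw [List.drop_eq_getElem_cons hi] at h
    cases h with
    | cons k b h h1 h0 hb hb' hbp hd =>
      obtain ⟨c, hc, y, hy, rfl⟩ := exists_pow_mul_of_mem_sup hp.pos (hL k) h1 h0 hb hbp hx
      obtain ⟨w, hw, hwi, rfl⟩ := ih h hy
      refine ⟨List.replicate c ⟨i, hi⟩ ++ w, ?_, ?_, ?_⟩
      · refine IsNormalWord.append ⟨by simp [List.pairwise_replicate], fun j => ?_⟩ hw ?_
        · have := hp.pos; rw [List.count_replicate]; change _ < p; split_ifs <;> omega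
        · intro a ha b hb
          rw [List.eq_of_mem_replicate ha]
          exact hwi b hb
      · intro j hj
        rcases List.mem_append.1 hj with hj | hj
        · rw [List.eq_of_mem_replicate hj]
        · exact (Nat.le_succ i).trans (hwi j hj)
      · simp

theorem GenSeq.levelBasis [Finite G] (hL : ∀ k, ⁅L k, L k⁆ ≤ L (k + 1)) (hle : Antitone L)
    (hp : p.Prime) (hG : IsPGroup p G) {as : List G} (h : GenSeq p L as ⊤) :
    LevelBasis p L as.get where
  card := by rw [← h.card hL hp hG]; simp
  upper k i j hij hi := by
    obtain ⟨H, hH⟩ := h.exists_drop i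
    have h1 := hH
    rw [List.drop_eq_getElem_cons i.2] at h1
    refine h1.le_of_mem hle hi (hH.mem_of_mem _ ?_)
    rw [List.mem_drop_iff_getElem]
    exact ⟨j - i, by have := j.2; omega, by simp [Nat.add_sub_cancel' (show (i : ℕ) ≤ j from hij)]⟩
  level i := by
    obtain ⟨H, hH⟩ := h.exists_drop i
    rw [List.drop_eq_getElem_cons i.2] at hH
    cases hH with
    | cons k b h h1 h0 hb hb' hbp hd =>
      refine ⟨k, hb, fun hc => hb' (h1 hc), hd.imp id fun hd => ?_⟩
      rw [List.head?_drop] at hd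
      obtain ⟨hi, hd⟩ := List.getElem?_eq_some_iff.1 hd
      exact ⟨⟨i + 1, hi⟩, rfl, hd.symm⟩
  exists_word k x hx := by
    obtain ⟨i, hi⟩ := h.exists_drop_eq hle (k := k) le_top
    rcases le_or_gt i as.length with hlen | hlen
    · obtain ⟨w, hw, hwi, hwx⟩ := hi.exists_word hL hp hlen hx
      refine ⟨w, hw, fun j hj => hi.mem_of_mem _ ?_, hwx⟩
      rw [List.mem_drop_iff_getElem]
      exact ⟨j - i, by have := j.2; have := hwi j hj; omega,
        by simp [Nat.add_sub_cancel' (hwi j hj)]⟩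
    · rw [List.drop_eq_nil_of_le hlen.le] at hi
      generalize L k = K at hi hx
      cases hi
      rw [Subgroup.mem_bot] at hx
      exact ⟨[], isNormalWord_nil fun _ => hp.pos, by simp, by simp [hx]⟩

end LevelBasis

/-! ### Consistency from collection -/

namespace PolycyclicPresentation

variable {m : ℕ} {F : PolycyclicPresentation m}

section Presents

open PresentedGroup

/-- The element of the presented group that a word represents. -/
def wordElement (F : PolycyclicPresentation m) (w : PWord m) : PresentedGroup F.relators :=
  (w.map PresentedGroup.of).prod

theorem mk_toFree (w : PWord m) : PresentedGroup.mk F.relators (toFree w) = F.wordElement w := by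
  simp only [toFree, wordElement, map_list_prod, List.map_map]
  rfl

theorem Rel.wordElement_eq {l r : PWord m} (h : F.Rel l r) :
    F.wordElement l = F.wordElement r := by
  rw [← mk_toFree, ← mk_toFree]
  exact mk_eq_mk_of_mul_inv_mem ⟨l, r, h, rfl⟩

theorem LeftCollects.wordElement_eq {k : ℕ} {w z : PWord m} (h : F.LeftCollects k w z) :
    F.wordElement w = F.wordElement z := by
  induction h with
  | refl => rfl
  | step hs _ ih =>
    rw [← ih]
    obtain ⟨x, l, r, y, hr, rfl, rfl, -⟩ := hs
    have := hr.wordElement_eq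
    simp only [wordElement, List.map_append, List.prod_append] at this ⊢
    rw [this]

/-- A group in which the relations of `F` hold and which has the right order is presented by `F`,
if every product of normal words can be collected. -/
theorem presents_and_consistent {G : Type*} [Group G] (he : ∀ i, 1 < F.e i)
    (hcol : ∀ u w, IsNormalWord F.e u → IsNormalWord F.e w →
      ∃ k z, F.LeftCollects k (u ++ w) z ∧ IsNormalWord F.e z)
    (a : Fin m → G) (hrel : ∀ l r, F.Rel l r → (l.map a).prod = (r.map a).prod)
    (hgen : ∀ x, ∃ w : PWord m, (w.map a).prod = x) (hcard : Nat.card G = ∏ i, F.e i) :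
    F.Presents G ∧ F.Consistent := by
  have hpos : 0 < ∏ i, F.e i := Finset.prod_pos fun i _ => F.e_pos i
  -- The elements represented by normal words are closed under products because collection succeeds.
  -- They are finitely many, since exponent vectors separate normal words.
  let S : Submonoid (PresentedGroup F.relators) :=
    { carrier := {x | ∃ w, IsNormalWord F.e w ∧ F.wordElement w = x}
      one_mem' := ⟨[], isNormalWord_nil F.e_pos, rfl⟩
      mul_mem' := by
        rintro _ _ ⟨u, hu, rfl⟩ ⟨w, hw, rfl⟩
        obtain ⟨k, z, hk, hz⟩ := hcol u w hu hw
        refine ⟨z, hz, ?_⟩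
        rw [← hk.wordElement_eq]
        simp [wordElement] }
  have hS : ∀ x : S, ∃ w, IsNormalWord F.e w ∧ F.wordElement w = x := fun x => x.2
  choose nf hnf hnfx using hS
  let c : S → ((i : Fin m) → Fin (F.e i)) := fun x i => ⟨(nf x).count i, (hnf x).2 i⟩
  have hc : Function.Injective c := by
    intro x y hxy
    have h1 : (nf x).Perm (nf y) := List.perm_iff_count.2 fun i =>
      congrArg Fin.val (congrFun hxy i)
    have h2 : nf x = nf y := h1.eq_of_pairwise' (hnf x).1 (hnf y).1
    exact Subtype.ext (by rw [← hnfx x, ← hnfx y, h2])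
  have hfin : Finite S := Finite.of_injective c hc
  -- In a finite submonoid of a group inverses are powers, so `S` is a subgroup; it contains the
  -- generators and hence is everything.
  let H : Subgroup (PresentedGroup F.relators) :=
    { S with
      inv_mem' := by
        intro x hx
        have h1 : (Submonoid.powers x : Set (PresentedGroup F.relators)).Finite :=
          (Set.toFinite (S : Set (PresentedGroup F.relators))).subset
            (by simpa using (Submonoid.powers_le.2 hx))
        have h2 : IsOfFinOrder x := finite_powers.1 h1
        have h3 : x⁻¹ ∈ Submonoid.powers x :=
          h2.mem_powers_iff_mem_zpowers.2 (inv_mem (Subgroup.mem_zpowers x))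
        exact (Submonoid.powers_le.2 hx) h3 }
  have hall : ∀ x, x ∈ S := fun x => generated_by F.relators H
    (fun j => ⟨[j], isNormalWord_singleton he j, by simp [wordElement]⟩) x
  let c' : PresentedGroup F.relators → ((i : Fin m) → Fin (F.e i)) := fun x => c ⟨x, hall x⟩
  have hc' : Function.Injective c' := fun x y h => congrArg Subtype.val (hc h)
  have hfin' : Finite (PresentedGroup F.relators) := Finite.of_injective c' hc'
  have hle : Nat.card (PresentedGroup F.relators) ≤ ∏ i, F.e i := by
    simpa [Nat.card_pi] using Nat.card_le_card_of_injective c' hc'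
  have hlift : ∀ w : PWord m, FreeGroup.lift a (toFree w) = (w.map a).prod := by
    intro w
    simp [toFree, map_list_prod, Function.comp_def]
  have hker : ∀ r ∈ F.relators, FreeGroup.lift a r = 1 := by
    rintro _ ⟨l, r, h, rfl⟩
    rw [map_mul, map_inv, hlift, hlift, hrel l r h, mul_inv_cancel]
  let φ : PresentedGroup F.relators →* G := toGroup hker
  have hφ : Function.Surjective φ := by
    intro x
    obtain ⟨w, rfl⟩ := hgen x
    exact ⟨F.wordElement w, by simp [wordElement, map_list_prod, φ, Function.comp_def]⟩
  -- The surjection onto `G` matches the upper bound from normal words, so it is an isomorphism.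
  have hge : Nat.card G ≤ Nat.card (PresentedGroup F.relators) :=
    Nat.card_le_card_of_surjective φ hφ
  have heq : Nat.card (PresentedGroup F.relators) = Nat.card G := by omega
  refine ⟨⟨MulEquiv.ofBijective φ ((Nat.bijective_iff_surjective_and_card φ).2 ⟨hφ, heq⟩)⟩,
    heq.trans hcard⟩

end Presents

end PolycyclicPresentation

/-! ### The favourable presentation of a basis -/

section Construct

open scoped commutatorElement

variable {G : Type*} [Group G] {p m : ℕ} {L : ℕ → Subgroup G} {a : Fin m → G}

/-- The right-hand sides needed for a favourable presentation with respect to a `LevelBasis`. -/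
structure IsRightHandSide (p : ℕ) (L : ℕ → Subgroup G) (a : Fin m → G) (lv : Fin m → ℕ)
    (i j : Fin m) (w : PWord m) : Prop where
  normal : IsNormalWord (fun _ => p) w
  lt : ∀ k ∈ w, i < k
  power : i = j → (w.map a).prod = a i ^ p ∧
    ((∃ k : Fin m, (k : ℕ) = i + 1 ∧ w = [k]) ∨ ∀ k ∈ w, lv i < lv k)
  conj : i < j → (w.map a).prod = (a i)⁻¹ * a j * a i
  same : i < j → lv j = lv i → ∃ u, (∀ k ∈ u, lv i < lv k) ∧ w = j :: u
  next : i < j → lv i < lv j → (∀ k ∈ w, lv i < lv k) ∧ (⁅a i, a j⁆ = 1 → w = [j])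

theorem LevelBasis.exists_level (h : LevelBasis p L a) (hle : Antitone L) :
    ∃ lv : Fin m → ℕ, Monotone lv ∧ (∀ i k, a i ∈ L k ↔ k ≤ lv i) ∧
      ∀ i, a i ^ p ∈ L (lv i + 1) ∨ ∃ j : Fin m, (j : ℕ) = i + 1 ∧ a i ^ p = a j := by
  choose lv h1 h2 h3 using h.level
  have hiff : ∀ i k, a i ∈ L k ↔ k ≤ lv i := by
    intro i k
    refine ⟨fun hk => ?_, fun hk => hle hk (h1 i)⟩
    by_contra! hlt
    exact h2 i (hle hlt hk)
  exact ⟨lv, fun i j hij => (hiff j _).1 (h.upper _ i j hij (h1 i)), hiff, h3⟩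

/-- Within a level, the conjugate of a_j by a_i is a_j [a_j⁻¹, a_i⁻¹], and the commutator lies in
the next term of the series. A deeper a_j has its conjugate in the next term by normality. -/
theorem LevelBasis.exists_rightHandSide (hp : p.Prime) (h : LevelBasis p L a)
    (hL : ∀ k, ⁅L k, L k⁆ ≤ L (k + 1)) (hnorm : ∀ k, (L k).Normal)
    {lv : Fin m → ℕ} (hlv : Monotone lv) (hiff : ∀ i k, a i ∈ L k ↔ k ≤ lv i)
    (hpow : ∀ i, a i ^ p ∈ L (lv i + 1) ∨ ∃ j : Fin m, (j : ℕ) = i + 1 ∧ a i ^ p = a j)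
    {i j : Fin m} (hij : i ≤ j) : ∃ w, IsRightHandSide p L a lv i j w := by
  have hlt : ∀ {k : Fin m}, lv i < lv k → i < k := fun {k} hk => by
    by_contra! hki
    exact absurd (hlv hki) (by omega)
  have hword : ∀ x ∈ L (lv i + 1), ∃ w : PWord m, IsNormalWord (fun _ => p) w ∧
      (∀ k ∈ w, lv i < lv k) ∧ (w.map a).prod = x := by
    intro x hx
    obtain ⟨w, hw, hwl, hwx⟩ := h.exists_word _ x hx
    exact ⟨w, hw, fun k hk => (hiff k _).1 (hwl k hk), hwx⟩
  have hp1 : ∀ _ : Fin m, 1 < p := fun _ => hp.one_lt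
  have hai : a i ∈ L (lv i) := (hiff i _).2 le_rfl
  rcases hij.eq_or_lt with rfl | hij
  · rcases hpow i with hi | ⟨k, hk, hik⟩
    · obtain ⟨w, hw, hwl, hwx⟩ := hword _ hi
      exact ⟨w, hw, fun k hk => hlt (hwl k hk), fun _ => ⟨hwx, .inr hwl⟩,
        fun h => absurd h (lt_irrefl _), fun h => absurd h (lt_irrefl _),
        fun h => absurd h (lt_irrefl _)⟩
    · refine ⟨[k], isNormalWord_singleton hp1 k, ?_, fun _ => ⟨by simp [hik], .inl ⟨k, hk, rfl⟩⟩,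
        fun h => absurd h (lt_irrefl _), fun h => absurd h (lt_irrefl _),
        fun h => absurd h (lt_irrefl _)⟩
      simp only [List.mem_singleton, forall_eq, Fin.lt_def]; omega
  · rcases (hlv hij.le).eq_or_lt with heq | hl
    · have haj : a j ∈ L (lv i) := (hiff j _).2 heq.le
      obtain ⟨u, hu, hul, hux⟩ := hword ⁅(a j)⁻¹, (a i)⁻¹⁆
        (hL _ (Subgroup.commutator_mem_commutator (inv_mem haj) (inv_mem hai)))
      have hju : ∀ k ∈ u, j < k := fun k hk => by
        by_contra! hkj
        have := hlv hkj
        have := hul k hk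
        omega
      refine ⟨j :: u, (isNormalWord_singleton hp1 j).append hu (by simpa using hju), ?_,
        fun h => absurd h hij.ne, fun _ => ?_, fun _ _ => ⟨u, hul, rfl⟩, fun _ h => absurd heq h.ne⟩
      · intro k hk
        rcases List.mem_cons.1 hk with rfl | hk
        · exact hij
        · exact hij.trans (hju k hk)
      · rw [List.map_cons, List.prod_cons, hux, commutatorElement_def]; group
    -- For commuting letters the one-letter word is chosen explicitly; the sharper bound for
    -- commuting levels depends on its length being 1.
    · by_cases hcomm : ⁅a i, a j⁆ = 1
      · refine ⟨[j], isNormalWord_singleton hp1 j, by simpa using hij,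
          fun h => absurd h hij.ne, fun _ => ?_, fun _ h => absurd h hl.ne',
          fun _ _ => ⟨by simpa using hl, fun _ => rfl⟩⟩
        rw [commutatorElement_eq_one_iff_mul_comm] at hcomm
        rw [mul_assoc, ← hcomm]; simp
      · have haj : (a i)⁻¹ * a j * a i ∈ L (lv i + 1) := by
          simpa using (hnorm (lv i + 1)).conj_mem _ ((hiff j _).2 hl) (a i)⁻¹
        obtain ⟨w, hw, hwl, hwx⟩ := hword _ haj
        exact ⟨w, hw, fun k hk => hlt (hwl k hk), fun h => absurd h hij.ne, fun _ => hwx,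
          fun _ h => absurd h hl.ne', fun _ _ => ⟨hwl, fun h => absurd h hcomm⟩⟩

/-- A monotone map into the natural numbers factors through a monotone surjection onto a chain. -/
theorem Monotone.exists_surjective_fin {f : Fin m → ℕ} (hf : Monotone f) :
    ∃ (d : ℕ) (δ : Fin m → Fin d), Monotone δ ∧ Function.Surjective δ ∧
      ∀ i j, f i < f j → δ i < δ j := by
  classical
  let s := Finset.univ.image f
  let o := s.orderIsoOfFin rfl
  have hs : ∀ i, f i ∈ s := fun i => Finset.mem_image_of_mem f (Finset.mem_univ i)
  refine ⟨s.card, fun i => o.symm ⟨f i, hs i⟩, fun i j hij => o.symm.monotone (hf hij), ?_,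
    fun i j hij => o.symm.strictMono hij⟩
  intro x
  obtain ⟨i, -, hi⟩ := Finset.mem_image.1 (o x).2
  refine ⟨i, ?_⟩
  rw [OrderIso.symm_apply_eq]
  exact Subtype.ext hi

open PolycyclicPresentation in
theorem LevelBasis.exists_presentation (hp : p.Prime) (h : LevelBasis p L a)
    (hL : ∀ k, ⁅L k, L k⁆ ≤ L (k + 1)) (hle : Antitone L) (hnorm : ∀ k, (L k).Normal)
    (hm : 0 < m) :
    ∃ (F : PolycyclicPresentation m) (lv : Fin m → ℕ), Monotone lv ∧
      (∀ i k, a i ∈ L k ↔ k ≤ lv i) ∧ (∀ i, F.e i = p) ∧ F.Favourable ∧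
      ∀ i j, i ≤ j → IsRightHandSide p L a lv i j (F.v i j) := by
  obtain ⟨lv, hlv, hiff, hpow⟩ := h.exists_level hle
  choose! v hv using fun i j (hij : i ≤ j) =>
    h.exists_rightHandSide hp hL hnorm hlv hiff hpow hij
  -- A favourable presentation asks for a surjective level function, so `lv` is replaced with its
  -- rank within its image.
  obtain ⟨d, δ, hδ, hδs, hδl⟩ := hlv.exists_surjective_fin
  refine ⟨⟨fun _ => p, v, fun _ => hp.pos, fun i j hij => (hv i j hij).normal,
    fun i j hij => (hv i j hij).lt⟩, lv, hlv, hiff, fun _ => rfl,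
    ⟨d, (δ ⟨0, hm⟩).pos, δ, hδ, hδs, fun i => ?_, fun i j hij => ?_⟩, hv⟩
  · exact ((hv i i le_rfl).power rfl).2.imp id
      fun hk => ⟨(hv i i le_rfl).normal, fun k hk' => hδl _ _ (hk k hk')⟩
  · have hij' := hv i j hij.le
    refine ⟨hij'.normal, ?_⟩
    rcases (hlv hij.le).eq_or_lt with heq | hl
    · obtain ⟨u, hu, hw⟩ := hij'.same hij heq.symm
      refine ⟨u, hij'.normal.sublist (by simp [hw]), fun k hk => hδl _ _ (hu k hk), .inr hw⟩
    · exact ⟨v i j, hij'.normal, fun k hk => hδl _ _ ((hij'.next hij hl).1 k hk), .inl rfl⟩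

end Construct

/-! ### Counting steps over all levels -/

namespace PolycyclicPresentation

variable {m : ℕ} {F : PolycyclicPresentation m}

theorem LetterBound.mono {A : Finset (Fin m)} {f f' : ℕ} (h : F.LetterBound A f) (hf : f ≤ f') :
    F.LetterBound A f' := fun Q T b hn hQ hT hb =>
  let ⟨T', h1, h2, h3⟩ := h Q T b hn hQ hT hb
  ⟨T', h1, h2, h3.mono hf⟩

theorem letterBound_empty (f : ℕ) : F.LetterBound ∅ f := fun _ _ _ _ _ _ hb => by simp at hb

/-- The bound from one level to the previous one, in terms of the numbers of letters. -/
theorem LevelStep.letterBound_card {p : ℕ} (hp : 1 < p) (he : ∀ i, F.e i = p)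
    {A B : Finset (Fin m)} {V f f' : ℕ} (hAB : F.LevelStep A B V) (hf : F.LetterBound B f)
    (hff' : f ≤ f')
    (hf' : ∀ N M : ℕ, M = B.card * (p - 1) → N + M + (p - 1) ≤ m * (p - 1) →
      N + M + 1 + N * (M + 1 + M * V * f + M * f) + M * V * f ≤ f') :
    F.LetterBound A f' := by
  have he' : ∀ i, 1 < F.e i := fun i => by rw [he]; exact hp
  -- The letter `i` itself does not occur among the letters of its level that it passes, whence the
  -- `- 1`. This leaves room for `p - 1` in the total m(p-1), so that N + M + 1 ≤ m(p-1).
  refine hAB.letterBound he' hf (M := B.card * (p - 1)) (N := ((A \ B).card - 1) * (p - 1))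
    (fun w hw hwB => ?_) (fun i hi hiB w hw hwA => ?_) hff' ?_
  · simpa [he] using length_le_of_isNormalWord hw hwB
  · have h1 := length_le_of_isNormalWord hw (A := (A \ B).erase i) fun t ht => by
      obtain ⟨h1, h2, h3⟩ := hwA t ht
      simp [h1, h2, h3.ne']
    simpa [he, Finset.card_erase_of_mem, hi, hiB] using h1
  · rintro ⟨i, hi, hiB⟩
    refine hf' _ _ rfl ?_
    have h1 : 0 < (A \ B).card := Finset.card_pos.2 ⟨i, by simp [hi, hiB]⟩
    have h2 : (A \ B).card + B.card ≤ m := by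
      rw [Finset.card_sdiff_add_card_eq_card hAB.subset]
      simpa using Finset.card_le_univ A
    have h3 := Nat.mul_le_mul_right (p - 1) h2
    obtain ⟨c, hc⟩ : ∃ c, (A \ B).card = c + 1 := ⟨_, (Nat.succ_pred_eq_of_pos h1).symm⟩
    rw [hc, Nat.add_sub_cancel]
    rw [hc] at h3
    calc c * (p - 1) + B.card * (p - 1) + (p - 1) = (c + 1 + B.card) * (p - 1) := by ring
      _ ≤ _ := h3

variable {G : Type*} [Group G] {p : ℕ} {L : ℕ → Subgroup G} {a : Fin m → G} {lv : Fin m → ℕ}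

theorem levelStep_of_rightHandSide (hlv : Monotone lv)
    (hrhs : ∀ i j, i ≤ j → IsRightHandSide p L a lv i j (F.v i j)) (k : ℕ) {V : ℕ}
    (hV : ∀ i j, i < j → lv i = k → k < lv j → (F.v i j).length ≤ V) :
    F.LevelStep (Finset.univ.filter (k ≤ lv ·)) (Finset.univ.filter (k + 1 ≤ lv ·)) V := by
  have hupper : ∀ k, IsUpperSet ((Finset.univ.filter (k ≤ lv ·) : Finset (Fin m)) :
      Set (Fin m)) := fun k i j hij hi => by
    simp at hi ⊢
    exact hi.trans (hlv hij)
  refine ⟨hupper k, hupper (k + 1), fun i hi => ?_, fun i hi hi' => ?_, fun i hi j hij hj => ?_,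
    fun i hi hi' j hj => ?_⟩ <;> simp only [Finset.mem_filter_univ] at *
  · omega
  · exact ((hrhs i i le_rfl).power rfl).2.imp id fun h k' hk' => by have := h k' hk'; omega
  · have h1 := hlv hij.le
    obtain ⟨u, hu, huv⟩ := (hrhs i j hij.le).same hij (by omega)
    exact ⟨u, fun t ht => by have := hu t ht; omega, huv⟩
  · have hlt : lv i < lv j := by omega
    have hij : i < j := by
      by_contra! h
      have := hlv h
      omega
    refine ⟨fun t ht => ?_, hV i j hij (by omega) (by omega)⟩
    have := ((hrhs i j hij.le).next hij hlt).1 t ht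
    omega

/-- There are no deeper letters, so the recursion reduces to 2N + 1: at most N swaps, one power
relation for the moved letter and one for each letter passed. The exact form matters for `m = 1`,
where it gives a single step. -/
theorem letterBound_bottom (hp : 1 < p) (he : ∀ i, F.e i = p) (hlv : Monotone lv)
    (hrhs : ∀ i j, i ≤ j → IsRightHandSide p L a lv i j (F.v i j)) {k : ℕ}
    (hk : ∀ i, lv i ≤ k) :
    F.LetterBound (Finset.univ.filter (k ≤ lv ·)) (2 * (m * (p - 1) - (p - 1)) + 1) := by
  have hempty : (Finset.univ.filter (k + 1 ≤ lv ·) : Finset (Fin m)) = ∅ := by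
    ext i; have := hk i; simp; omega
  have hstep := levelStep_of_rightHandSide hlv hrhs k (V := 0)
    fun i j _ _ h => absurd (hk j) (by omega)
  rw [hempty] at hstep
  refine hstep.letterBound_card hp he (letterBound_empty 0) (Nat.zero_le _) fun N M hM hN => ?_
  simp only [Finset.card_empty, zero_mul] at hM
  subst hM
  simp only [mul_zero, add_zero, zero_add, mul_one]
  omega

/-- A conjugate of a deeper letter is a normal word in deeper letters, so `V = M` is possible. The
cubic polynomial that results leaves enough room to absorb a factor 2 in the deeper bound. -/
theorem letterBound_succ (hp : 1 < p) (he : ∀ i, F.e i = p) (hlv : Monotone lv)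
    (hrhs : ∀ i j, i ≤ j → IsRightHandSide p L a lv i j (F.v i j)) {k f : ℕ} (hN2 : 2 ≤ m * (p - 1))
    (hf1 : 1 ≤ f) (hf : F.LetterBound (Finset.univ.filter (k + 1 ≤ lv ·)) (2 * f)) :
    F.LetterBound (Finset.univ.filter (k ≤ lv ·)) ((m * (p - 1)) ^ 3 * f) := by
  have hstep := levelStep_of_rightHandSide hlv hrhs k
    (V := (Finset.univ.filter (k + 1 ≤ lv ·)).card * (p - 1)) fun i j hij hi hj => by
      have h1 := ((hrhs i j hij.le).next hij (by omega)).1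
      have h2 := length_le_of_isNormalWord (F.v_normal i j hij.le)
        (A := Finset.univ.filter (k + 1 ≤ lv ·)) fun t ht => by
          have := h1 t ht
          simp only [Finset.mem_filter_univ]; omega
      simpa [he] using h2
  refine hstep.letterBound_card hp he hf ?_ fun N M hM hN => ?_
  · exact Nat.mul_le_mul_right f (hN2.trans (Nat.le_self_pow (by norm_num) _))
  rw [← hM]
  have h1 : N + M + 1 ≤ m * (p - 1) := by omega
  have h2 : N + M + 1 + N * (M + 1) + 2 * (N * M * M + N * M + M * M) ≤ (N + M + 1) ^ 3 := by
    ring_nf; nlinarith [Nat.zero_le (N * M), Nat.zero_le (N * M * M)]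
  calc N + M + 1 + N * (M + 1 + M * M * (2 * f) + M * (2 * f)) + M * M * (2 * f)
      = (N + M + 1 + N * (M + 1)) + 2 * (N * M * M + N * M + M * M) * f := by ring
    _ ≤ (N + M + 1 + N * (M + 1)) * f + 2 * (N * M * M + N * M + M * M) * f :=
        Nat.add_le_add_right (Nat.le_mul_of_pos_right _ hf1) _
    _ = (N + M + 1 + N * (M + 1) + 2 * (N * M * M + N * M + M * M)) * f := by ring
    _ ≤ (N + M + 1) ^ 3 * f := Nat.mul_le_mul_right f h2
    _ ≤ _ := Nat.mul_le_mul_right f (Nat.pow_le_pow_left h1 3)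

-- Commuting letters have conjugates of length `V = 1`, so the recursion applied to 2K is only
-- quadratic in `N` and `M`, and the result is K^3 instead of K^4.
open scoped commutatorElement in
theorem letterBound_of_commute (hp : 1 < p) (he : ∀ i, F.e i = p) (hlv : Monotone lv)
    (hrhs : ∀ i j, i ≤ j → IsRightHandSide p L a lv i j (F.v i j)) {k : ℕ} (hN2 : 2 ≤ m * (p - 1))
    (hcomm : ∀ i j, lv i = k → k < lv j → ⁅a i, a j⁆ = 1)
    (hf : F.LetterBound (Finset.univ.filter (k + 1 ≤ lv ·)) (2 * (m * (p - 1)))) :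
    F.LetterBound (Finset.univ.filter (k ≤ lv ·)) ((m * (p - 1)) ^ 3) := by
  have hstep := levelStep_of_rightHandSide hlv hrhs k (V := 1) fun i j hij hi hj => by
    rw [((hrhs i j hij.le).next hij (by omega)).2 (hcomm i j hi hj)]; rfl
  refine hstep.letterBound_card hp he hf ?_ fun N M hM hN => ?_
  · rw [pow_succ]; exact Nat.mul_le_mul_right _ (hN2.trans (Nat.le_self_pow (by norm_num) _))
  have h1 : N + M + 1 ≤ m * (p - 1) := by omega
  generalize m * (p - 1) = K at h1
  zify at h1 ⊢
  have hN0 : (0 : ℤ) ≤ N := by positivity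
  have hM0 : (0 : ℤ) ≤ M := by positivity
  have h2 : ((N : ℤ) + M + 1) ^ 2 ≤ (K : ℤ) ^ 2 := pow_le_pow_left₀ (by positivity) h1 2
  have h3 : (K : ℤ) * ((N : ℤ) + M + 1) ^ 2 ≤ K * (K : ℤ) ^ 2 :=
    mul_le_mul_of_nonneg_left h2 (by positivity)
  have h4 : (2 * (N : ℤ) + 1) * (N + M + 1) ≤ (2 * N + 1) * K :=
    mul_le_mul_of_nonneg_left h1 (by positivity)
  -- The term 4NMK of the recursion is at most (N + M)^2 K.
  have h5 : 0 ≤ (K : ℤ) * ((N : ℤ) - M) ^ 2 := by positivity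
  nlinarith

theorem LetterBound.univ_of_level (hp : 1 < p) (he : ∀ i, F.e i = p) (hlv : Monotone lv)
    (hrhs : ∀ i j, i ≤ j → IsRightHandSide p L a lv i j (F.v i j)) (hN2 : 2 ≤ m * (p - 1)) {k f : ℕ}
    (hf1 : 1 ≤ f) (hf : F.LetterBound (Finset.univ.filter (k ≤ lv ·)) f) :
    F.LetterBound Finset.univ ((m * (p - 1)) ^ (3 * k) * f) := by
  induction k generalizing f with
  | zero => simpa using hf
  | succ k ih =>
    have h := ih (Nat.mul_pos (pow_pos (by omega) 3) hf1)
      (letterBound_succ hp he hlv hrhs hN2 hf1 (hf.mono (by omega)))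
    rwa [← mul_assoc, ← pow_add, show 3 * k + 3 = 3 * (k + 1) by ring] at h

theorem LetterBound.exists_collects (hp : 1 < p) (he : ∀ i, F.e i = p) {f : ℕ}
    (hf : F.LetterBound Finset.univ f) {u w : PWord m} (hu : IsNormalWord F.e u)
    (hw : IsNormalWord F.e w) :
    ∃ k z, F.LeftCollects k (u ++ w) z ∧ IsNormalWord F.e z ∧ k ≤ m * (p - 1) * f := by
  have he' : ∀ i, 1 < F.e i := fun i => by rw [he]; exact hp
  obtain ⟨z, hz, -, k, hk, hkz⟩ := hf.word he' (Q := []) (T := u) w hu (by simp) (by simp) (by simp)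
  refine ⟨k, z, hkz, hz, hk.trans (Nat.mul_le_mul_right f ?_)⟩
  simpa [he] using length_le_of_isNormalWord hw (A := Finset.univ) (by simp)

open scoped commutatorElement in
/-- The bound for the bottom levels `L_E` and `L_(E-1)`, where `L_(E+1)` is trivial, combined with
the bounds for the other levels. -/
theorem exists_letterBound_univ (hp : 1 < p) (he : ∀ i, F.e i = p) (hlv : Monotone lv)
    (hrhs : ∀ i j, i ≤ j → IsRightHandSide p L a lv i j (F.v i j)) (hm : 0 < m) {E : ℕ}
    (hE : ∀ i, lv i ≤ E) (hEm : 2 ^ E ≤ m)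
    (hcomm : 2 * m < 3 * 2 ^ E → ∀ k, E = k + 1 → ∀ i j, lv i = k → k < lv j →
      ⁅a i, a j⁆ = 1) :
    ∃ t : ℕ, 2 ^ t ≤ m ^ 3 ∧ F.LetterBound Finset.univ ((m * (p - 1)) ^ t) := by
  have hN1 : 0 < m * (p - 1) := Nat.mul_pos hm (by omega)
  have hbot := letterBound_bottom hp he hlv hrhs hE
  have hbot' := hbot.mono (f' := 2 * (m * (p - 1))) (by
    have : p - 1 ≤ m * (p - 1) := Nat.le_mul_of_pos_left _ hm
    omega)
  by_cases hm1 : m = 1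
  · subst hm1
    have hE0 : E = 0 := by
      by_contra h
      exact absurd hEm (by have := Nat.one_lt_two_pow h; omega)
    subst hE0
    refine ⟨0, by norm_num, ?_⟩
    simpa using hbot
  have hm2 : 2 ≤ m := by omega
  have hN2 : 2 ≤ m * (p - 1) := hm2.trans (Nat.le_mul_of_pos_right m (by omega))
  -- With a single level, 2K ≤ K^2 and 2^2 ≤ m^3.
  rcases E with _ | k
  · refine ⟨2, by nlinarith [Nat.pow_le_pow_left hm2 3], ?_⟩
    have h1 := hbot'.mono (f' := (m * (p - 1)) ^ 2) (by rw [sq]; exact Nat.mul_le_mul_right _ hN2)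
    simpa using h1
  by_cases hcase : 3 * 2 ^ (k + 1) ≤ 2 * m
  · refine ⟨3 * (k + 1) + 1, ?_, ?_⟩
    -- Cubing gives 2 · 2^{3E} ≤ (16/27) m^3, which pays for the surplus exponent.
    · have h1 : (3 * 2 ^ (k + 1)) ^ 3 ≤ (2 * m) ^ 3 := Nat.pow_le_pow_left hcase 3
      have h2 : 2 ^ (3 * (k + 1) + 1) = 2 * (2 ^ (k + 1)) ^ 3 := by ring
      rw [h2]
      rw [mul_pow, mul_pow] at h1
      omega
    · have h1 := letterBound_succ hp he hlv hrhs hN2 (by omega) hbot'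
      have h2 := h1.univ_of_level hp he hlv hrhs hN2 (Nat.mul_pos (pow_pos hN1 3) hN1)
      rwa [← pow_succ, ← pow_add, show 3 * k + (3 + 1) = 3 * (k + 1) + 1 by ring] at h2
  · push Not at hcase
    refine ⟨3 * (k + 1), ?_, ?_⟩
    · rw [mul_comm, pow_mul]; exact Nat.pow_le_pow_left hEm 3
    · have h1 := letterBound_of_commute hp he hlv hrhs hN2 (hcomm hcase k rfl) hbot'
      have h2 := h1.univ_of_level hp he hlv hrhs hN2 (pow_pos hN1 3)
      rwa [← pow_add] at h2

end PolycyclicPresentation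

/-! ### The bound in terms of logarithms, and the theorem -/

theorem pow_succ_le_rpow_logb {m t : ℕ} (ht : 2 ^ t ≤ m ^ 3) {x : ℝ} (hx : 1 ≤ x) :
    x ^ (t + 1) ≤ x ^ (3 * Real.logb 2 m + 1) := by
  have h1 : (t : ℝ) ≤ 3 * Real.logb 2 m := by
    have h2 : Real.logb 2 ((2 : ℝ) ^ t) ≤ Real.logb 2 ((m : ℝ) ^ 3) :=
      Real.logb_le_logb_of_le (by norm_num) (by positivity) (by exact_mod_cast ht)
    rw [Real.logb_pow, Real.logb_pow, Real.logb_self_eq_one (by norm_num)] at h2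
    simpa using h2
  rw [← Real.rpow_natCast]
  exact Real.rpow_le_rpow_of_exponent_le hx (by push_cast; linarith)

theorem mainTheorem2 (p : ℕ) (hp : p.Prime) (G : Type*) [Group G] [Finite G] [Nontrivial G]
    (hG : IsPGroup p G) :
    ∃ (m : ℕ) (F : PolycyclicPresentation m),
      F.Presents G ∧ F.Consistent ∧ (∀ i, 1 < F.e i) ∧ F.Favourable ∧
      ∀ u w : PWord m, IsNormalWord F.e u → IsNormalWord F.e w →
        ∃ (k : ℕ) (z : PWord m), F.LeftCollects k (u ++ w) z ∧ IsNormalWord F.e z ∧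
          (k : ℝ) ≤ (((p : ℝ) - 1) * Real.logb p (Nat.card G)) ^
            (3 * Real.logb 2 (Real.logb p (Nat.card G)) + 1) := by
  classical
  have := Fact.mk hp
  have hnil : Group.IsNilpotent G := hG.isNilpotent
  -- As indices start at 0, this is γ_{2^k}.
  let L : ℕ → Subgroup G := fun k => (⊤ : Subgroup G).lowerCentralSeries (2 ^ k - 1)
  have hle : Antitone L := fun i j hij => Subgroup.lowerCentralSeries_antitone _
    (Nat.sub_le_sub_right (Nat.pow_le_pow_right (by norm_num) hij) 1)
  have hL' : ∀ i j, ⁅L i, L j⁆ ≤ (⊤ : Subgroup G).lowerCentralSeries (2 ^ i + 2 ^ j - 1) := by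
    intro i j
    refine (Subgroup.commutator_lowerCentralSeries_le _ _).trans (le_of_eq ?_)
    have := Nat.one_le_two_pow (n := i)
    have := Nat.one_le_two_pow (n := j)
    congr 1; omega
  have hL : ∀ k, ⁅L k, L k⁆ ≤ L (k + 1) := fun k => (hL' k k).trans (le_of_eq (by
    simp only [L, pow_succ]; congr 1; omega))
  have hnorm : ∀ k, (L k).Normal := fun k => Subgroup.lowerCentralSeries_normal _ _
  have hL0 : L 0 = ⊤ := rfl
  have hbot : ∃ k, L k = ⊥ := by
    obtain ⟨c, hc⟩ := Subgroup.nilpotent_iff_lowerCentralSeries.1 hnil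
    refine ⟨c, le_bot_iff.1 (hc ▸ Subgroup.lowerCentralSeries_antitone _ ?_)⟩
    have := Nat.lt_two_pow_self (n := c)
    omega
  obtain ⟨E, hE, hEne⟩ : ∃ E, L (E + 1) = ⊥ ∧ L E ≠ ⊥ := by
    obtain ⟨E, hE⟩ : ∃ E, Nat.find hbot = E + 1 := by
      refine ⟨Nat.find hbot - 1, (Nat.succ_pred_eq_of_ne_zero fun h => ?_).symm⟩
      have h1 := Nat.find_spec hbot
      rw [h, hL0] at h1
      exact top_ne_bot h1
    exact ⟨E, hE ▸ Nat.find_spec hbot, Nat.find_min hbot (by omega)⟩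
  obtain ⟨as, has⟩ := GenSeq.exists_of_series hL (fun k => hle k.le_succ) hnorm hp hG hE
    (Nat.zero_le _)
  obtain ⟨m, a, hbasis⟩ : ∃ (m : ℕ) (a : Fin m → G), LevelBasis p L a :=
    ⟨_, _, has.levelBasis hL hle hp hG⟩
  have hcard := hbasis.card
  have hm : 0 < m := by
    rcases Nat.eq_zero_or_pos m with h | h
    · rw [h, pow_zero] at hcard
      exact absurd hcard (Finite.one_lt_card (α := G)).ne'
    · exact h
  obtain ⟨F, lv, hlv, hiff, he, hfav, hrhs⟩ := hbasis.exists_presentation hp hL hle hnorm hm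
  have he' : ∀ i, 1 < F.e i := fun i => by rw [he]; exact hp.one_lt
  have hlvE : ∀ i, lv i ≤ E := by
    intro i
    by_contra! h
    have h1 : a i ∈ L (E + 1) := (hiff i _).2 h
    rw [hE, Subgroup.mem_bot] at h1
    -- A trivial generator would lie in every term of the series, whereas `lv i` is the last level
    -- containing it.
    have h2 := (hiff i (lv i + 1)).1 (h1 ▸ one_mem _)
    omega
  have hEm : 2 ^ E ≤ m := by
    have := Subgroup.lt_of_lowerCentralSeries_ne_bot hcard hEne
    omega
  obtain ⟨t, ht, hbound⟩ := PolycyclicPresentation.exists_letterBound_univ hp.one_lt he hlv hrhs hm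
    hlvE hEm (by
      rintro h k rfl i j hi hj
      -- The commutator lies in γ_{3·2^k}; if it were non-trivial, then 3·2^k ≤ m, against the
      -- hypothesis 2m < 3·2^{k+1}.
      have h1 := hL' k (k + 1) (Subgroup.commutator_mem_commutator ((hiff i k).2 hi.ge)
        ((hiff j (k + 1)).2 hj))
      by_contra hne
      have h2 := Subgroup.lt_of_lowerCentralSeries_ne_bot hcard
        (j := 2 ^ k + 2 ^ (k + 1) - 1) fun hb => hne (by rwa [hb, Subgroup.mem_bot] at h1)
      rw [pow_succ] at h h2
      omega)
  have hcol := fun u w hu hw => hbound.exists_collects hp.one_lt he (u := u) (w := w) hu hw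
  have hpres := F.presents_and_consistent he'
    (fun u w hu hw => let ⟨k, z, h1, h2, _⟩ := hcol u w hu hw; ⟨k, z, h1, h2⟩) a
    (by
      rintro _ _ (i | ⟨i, j, hij⟩)
      · rw [((hrhs i i le_rfl).power rfl).1, he]; simp
      · simp [(hrhs i j hij.le).conj hij, mul_assoc])
    (fun x => let ⟨w, _, _, h⟩ := hbasis.exists_word 0 x (by rw [hL0]; trivial); ⟨w, h⟩)
    (by rw [hcard]; simp [he])
  refine ⟨m, F, hpres.1, hpres.2, he', hfav, fun u w hu hw => ?_⟩
  obtain ⟨k, z, hk, hz, hle'⟩ := hcol u w hu hw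
  refine ⟨k, z, hk, hz, ?_⟩
  have hlog : Real.logb p (Nat.card G) = m := by
    rw [hcard]
    push_cast
    rw [Real.logb_pow, Real.logb_self_eq_one (by exact_mod_cast hp.one_lt), mul_one]
  have hx : (((m * (p - 1) : ℕ)) : ℝ) = ((p : ℝ) - 1) * m := by
    rw [Nat.cast_mul, Nat.cast_sub hp.one_lt.le, mul_comm]; simp
  rw [hlog, ← hx]
  refine le_trans ?_ (pow_succ_le_rpow_logb ht ?_)
  · rw [pow_succ']; exact_mod_cast hle'
  · have : 0 < m * (p - 1) := Nat.mul_pos hm (by have := hp.one_lt; omega)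
    exact_mod_cast this
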